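/- Let $\mathbf 2=\{0,1\}$. A finite-state transducer (FST) has a finite set of states $Q$, an initial state $q_0\in Q$, a transition function $\delta:Q\times\mathbf 2\to Q$ and an output function $\lambda:Q\times\mathbf 2\to\mathbf 2^*$; reading an infinite sequence from $q_0$ letter by letter, it outputs the concatenation of the words $\lambda(q,a)$. For $\sigma,\tau\in\mathbf 2^{\mathbb N}$ write $\sigma\ge\tau$ if some FST outputs $\tau$ on input $\sigma$, and $\sigma\equiv\tau$ if $\sigma\ge\tau$ and $\tau\ge\sigma$. For $f:\mathbb N\to\mathbb N$ let $\langle f\rangle = 1\,0^{f(0)}\,1\,0^{f(1)}\,1\,0^{f(2)}\cdots\in\mathbf 2^{\mathbb N}$ and $(\mathrm{shift}^k f)(n)=f(n+k)$. A weight is a tuple $\alpha=(a_0,\dots,a_{k-1},b)$ of rational numbers, $k\ge 0$, with $a_0,\dots,a_{k-1}\ge 0$; its length is $|\alpha|=k+1$, and $\alpha\cdot f=a_0f(0)+\cdots+a_{k-1}f(k-1)+b$. For a non-empty tuple of weights $\vec\alpha=(\alpha_0,\dots,\alpha_{m-1})$ the weighted product $\vec\alpha\otimes f:\mathbb N\to\mathbb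 Q$ is defined by $$(\vec\alpha\otimes f)(0)=\alpha_0\cdot f,\qquad (\vec\alpha\otimes f)(n+1)=(\vec\alpha'\otimes \mathrm{shift}^{|\alpha_0|-1}f)(n),$$ where $\vec\alpha'=(\alpha_1,\dots,\alpha_{m-1},\alpha_0)$. It is called natural if all its values lie in $\mathbb N$. A function $f:\mathbb N\to\mathbb N$ is spiralling if $\lim_{n\to\infty}f(n)=\infty$ and, for every $m\ge1$, the function $n\mapsto f(n)\bmod m$ is ultimately periodic. Theorem. Let $f:\mathbb N\to\mathbb N$ be spiralling and let $\sigma\in\mathbf 2^{\mathbb N}$. Then $\langle f\rangle\ge\sigma$ if and only if there are an integer $n_0\ge 0$ and a non-empty tuple of weights $\vec\alpha$ such that $\vec\alpha\otimes\mathrm{shift}^{n_0}f$ is natural and $\sigma\equiv\langle\vec\alpha\otimes\mathrm{shift}^{n_0}f\rangle$. -/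

import Mathlib

namespace Transducibility

/-! Letters of the alphabet `{0, 1}` are Booleans: `false` is the letter 0, `true` is the letter 1.
Finite words are lists, infinite sequences are functions on `ℕ`. -/

/-- The finite word consisting of the first `n` letters of the sequence `σ`. -/
def firstLetters (σ : ℕ → Bool) (n : ℕ) : List Bool :=
  (List.range n).map σ

/-- A complete, pure, sequential finite-state transducer with input and output alphabet
`{0, 1}`. -/
structure FST where
  /-- The set of states. -/
  State : Type
  /-- The set of states is finite. -/
  finite_state : Finite State
  /-- The initial state. -/
  start : State
  /-- The transition function. -/
  next : State → Bool → State
  /-- The output function. -/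
  out : State → Bool → List Bool

/-- The extension of the output function of `T` to finite words, reading from state `q`. -/
def FST.output (T : FST) : T.State → List Bool → List Bool
  | _, [] => []
  | q, a :: u => T.out q a ++ T.output (T.next q a) u

/-- `T.Transduces σ τ`: the function realised by `T` maps the infinite sequence `σ` to the infinite
sequence `τ`. That is, the (growing) finite outputs on the finite beginnings of `σ` are
beginnings of `τ`, and their lengths tend to infinity, so that their limit is the whole of `τ`. -/
def FST.Transduces (T : FST) (σ τ : ℕ → Bool) : Prop :=
  (∀ n : ℕ, T.output T.start (firstLetters σ n) =
    firstLetters τ (T.output T.start (firstLetters σ n)).length) ∧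
  Filter.Tendsto (fun n : ℕ => (T.output T.start (firstLetters σ n)).length)
    Filter.atTop Filter.atTop

/-- `σ ≥ τ`: the sequence `τ` is a transduct of `σ`. -/
def Reduces (σ τ : ℕ → Bool) : Prop :=
  ∃ T : FST, T.Transduces σ τ

/-- `σ ≡ τ`: each of the two sequences is a transduct of the other. -/
def Equivalent (σ τ : ℕ → Bool) : Prop :=
  Reduces σ τ ∧ Reduces τ σ

/-- The finite word `1 0^{f(0)} 1 0^{f(1)} ⋯ 1 0^{f(n-1)}`. -/
def blockWord (f : ℕ → ℕ) (n : ℕ) : List Bool :=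
  (List.range n).flatMap fun i => true :: List.replicate (f i) false

/-- The first `n` blocks have at least `n` letters in total. -/
theorem le_length_blockWord (f : ℕ → ℕ) (n : ℕ) : n ≤ (blockWord f n).length := by
  induction n with
  | zero => exact Nat.zero_le _
  | succ n ih =>
    have h : (blockWord f (n + 1)).length = (blockWord f n).length + (f n + 1) := by
      simp [blockWord, List.range_succ]
    omega

/-- The infinite sequence `⟨f⟩ = 1 0^{f(0)} 1 0^{f(1)} 1 0^{f(2)} ⋯`. Its `n`-th letter lies within
the first `n + 1` blocks, by `le_length_blockWord`. -/
def blockSeq (f : ℕ → ℕ) (n : ℕ) : Bool :=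
  (blockWord f (n + 1))[n]'(le_length_blockWord f (n + 1))

/-- A function on `ℕ` is ultimately periodic. -/
def UltimatelyPeriodic {A : Type*} (f : ℕ → A) : Prop :=
  ∃ n₀ p : ℕ, 0 < p ∧ ∀ n, n₀ ≤ n → f (n + p) = f n

/-- A function is spiralling if it tends to infinity and is ultimately periodic modulo every
`m ≥ 1`. -/
def Spiralling (f : ℕ → ℕ) : Prop :=
  Filter.Tendsto f Filter.atTop Filter.atTop ∧
  ∀ m : ℕ, 1 ≤ m → UltimatelyPeriodic fun n => f n % m

/-- The `k`-th shift of a function. -/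
def shift (k : ℕ) (f : ℕ → ℕ) : ℕ → ℕ := fun n => f (n + k)

/-- A weight `(a₀, …, a_{k-1}, b)`, a tuple of `k + 1` rational numbers with `a₀, …, a_{k-1} ≥ 0`;
here `coeffs = (a₀, …, a_{k-1})` and `const = b`. -/
structure Weight where
  coeffs : List ℚ
  const : ℚ
  coeffs_nonneg : ∀ a ∈ coeffs, 0 ≤ a

/-- `α · f = a₀ f(0) + a₁ f(1) + ⋯ + a_{k-1} f(k-1) + b`. -/
def Weight.apply (α : Weight) (f : ℕ → ℕ) : ℚ :=
  (∑ i : Fin α.coeffs.length, α.coeffs[i] * (f i : ℚ)) + α.const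

/-- The weighted product `α⃗ ⊗ f` of a tuple of weights and a function: the value at `0` is `α₀ · f`,
and the value at `n + 1` is the value at `n` of the weighted product of the rotated tuple
`(α₁, …, α_{m-1}, α₀)` and the `k`-th shift of `f`, where `k = |α₀| - 1` is the number of
coefficients of `α₀`. (For the empty tuple the product is not meaningful and set to `0`.) -/
def weightedProduct : List Weight → (ℕ → ℕ) → ℕ → ℚ
  | [], _, _ => 0
  | α :: _, f, 0 => α.apply f
  | α :: αs, f, n + 1 => weightedProduct (αs ++ [α]) (shift α.coeffs.length f) n

end Transducibility

/-! Weights give transducts. While reading `⟨f⟩`, a machine tracks the value of the current weight: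
each zero of block `n` adds the coefficient at `n`, and a zero is written whenever the integer part
grows. Only the residue of `n` and the remainder need to be stored. Coefficients are nonnegative, so
nothing is written too early; a negative constant is a bounded debt inside the remainder;
denominators are bounded, so finitely many states suffice (`CyclicWeights.reduces`).

Transducts come from weights. Reading zeros iterates a self-map of a finite state set, with some
period `P` after a preperiod. Since `f` tends to infinity and is ultimately periodic modulo `P`,
from some block on the output of block `n` is an initial word of length `a n` followed by `k n`
rounds of a word of length `A n`, where `f n = c n + P * k n` and everything but `k` depends only on
`n` modulo some `r` (`Spiralling.exists_blockData`).

So the output length of a block is affine in `f n` with nonnegative slope `A n / P`. It remains to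
encode `σ` by such lengths. As the blocks grow, what follows the start of block `n` converges along
`n + t * r` to a sequence `X n`. Predict that the loop of a block goes on for ever. If at every
block end this agrees with the limit of what follows, `σ` is ultimately periodic. Otherwise each `X
n` is ultimately periodic, so a finite state can make the predictions; they fail once for each
non-silent block end, at a bounded distance behind it. Adding the predictions to `σ` modulo 2 is
invertible and leaves ones exactly at the failures (`BlockData.exists_equivalent`). The gaps between
failures are sums of block lengths plus periodic constants, hence a weighted product
(`BlockData.exists_weights`). -/

namespace Transducibility

open Filter

/-! ### Runs, and the transducers they define -/

/-- A run of a transducer from `σ` to `τ`, given by its states `s n` and its output lengths `ℓ n`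
after reading `n` letters: state and letter determine the next state and the word written. -/
structure IsRun {S : Type*} (σ τ : ℕ → Bool) (s : ℕ → S) (ℓ : ℕ → ℕ) : Prop where
  zero : ℓ 0 = 0
  tendsto : Tendsto ℓ atTop atTop
  step : ∀ m n, s m = s n → σ m = σ n → s (m + 1) = s (n + 1) ∧
    ∃ L, ℓ (m + 1) = ℓ m + L ∧ ℓ (n + 1) = ℓ n + L ∧ ∀ i < L, τ (ℓ m + i) = τ (ℓ n + i)

theorem firstLetters_succ (σ : ℕ → Bool) (n : ℕ) :
    firstLetters σ (n + 1) = firstLetters σ n ++ [σ n] := by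
  simp [firstLetters, List.range_succ]

theorem firstLetters_add (σ : ℕ → Bool) (n k : ℕ) :
    firstLetters σ (n + k) = firstLetters σ n ++ firstLetters (fun i => σ (n + i)) k := by
  simp [firstLetters, List.range_add, Function.comp_def]

@[simp] theorem length_firstLetters (σ : ℕ → Bool) (n : ℕ) : (firstLetters σ n).length = n := by
  simp [firstLetters]

theorem firstLetters_congr {σ τ : ℕ → Bool} {n : ℕ} (h : ∀ i < n, σ i = τ i) :
    firstLetters σ n = firstLetters τ n := by
  simpa [firstLetters] using h

theorem eq_of_firstLetters_eq {σ τ : ℕ → Bool} {n : ℕ}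
    (h : firstLetters σ n = firstLetters τ n) : ∀ i < n, σ i = τ i := by
  simpa [firstLetters] using h

theorem FST.output_append (T : FST) (q : T.State) (u v : List Bool) :
    T.output q (u ++ v) = T.output q u ++ T.output (u.foldl T.next q) v := by
  induction u generalizing q with
  | nil => rfl
  | cons a u ih => simp [FST.output, ih]

/-- The state of `T` after reading `n` letters of `σ`. -/
def FST.stateAt (T : FST) (σ : ℕ → Bool) (n : ℕ) : T.State :=
  (firstLetters σ n).foldl T.next T.start

theorem FST.stateAt_succ (T : FST) (σ : ℕ → Bool) (n : ℕ) :
    T.stateAt σ (n + 1) = T.next (T.stateAt σ n) (σ n) := by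
  simp [FST.stateAt, firstLetters_succ]

theorem FST.output_succ (T : FST) (σ : ℕ → Bool) (n : ℕ) :
    T.output T.start (firstLetters σ (n + 1)) =
      T.output T.start (firstLetters σ n) ++ T.out (T.stateAt σ n) (σ n) := by
  simp [firstLetters_succ, FST.output_append, FST.stateAt, FST.output]

theorem FST.Transduces.isRun {T : FST} {σ τ : ℕ → Bool} (h : T.Transduces σ τ) :
    IsRun σ τ (T.stateAt σ) fun n => (T.output T.start (firstLetters σ n)).length where
  zero := rfl
  tendsto := h.2
  step := by
    have key (n : ℕ) : T.out (T.stateAt σ n) (σ n) =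
        firstLetters (fun i => τ ((T.output T.start (firstLetters σ n)).length + i))
          (T.out (T.stateAt σ n) (σ n)).length := by
      have h1 := h.1 (n + 1)
      rw [T.output_succ, List.length_append, firstLetters_add, ← h.1 n] at h1
      exact List.append_cancel_left h1
    intro m n hs hσ
    refine ⟨by rw [T.stateAt_succ, T.stateAt_succ, hs, hσ],
      (T.out (T.stateAt σ n) (σ n)).length, ?_, ?_, ?_⟩
    · simp [T.output_succ, hs, hσ]
    · simp [T.output_succ]
    · apply eq_of_firstLetters_eq
      rw [← key n]
      have := key m
      rw [hs, hσ] at this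
      exact this.symm

/-- Transducers are built below by giving only states and output lengths along one input. The tables
are read off from any occurrence of a state and a letter; `IsRun.step` makes the choice irrelevant,
and pairs that never occur get arbitrary entries. -/
theorem Reduces.of_isRun {S : Type} {σ τ : ℕ → Bool} {s : ℕ → S} {ℓ : ℕ → ℕ}
    (h : IsRun σ τ s ℓ) (hs : (Set.range s).Finite) : Reduces σ τ := by
  classical
  let T : FST :=
    { State := Set.range s
      finite_state := hs
      start := ⟨s 0, 0, rfl⟩
      next := fun q a => if h : ∃ n, s n = q ∧ σ n = a then ⟨s (h.choose + 1), _, rfl⟩ else q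
      out := fun q a => if h : ∃ n, s n = q ∧ σ n = a then
        firstLetters (fun i => τ (ℓ h.choose + i)) (ℓ (h.choose + 1) - ℓ h.choose) else [] }
  have key (n : ℕ) : (T.next ⟨s n, n, rfl⟩ (σ n)).1 = s (n + 1) ∧
      firstLetters τ (ℓ (n + 1)) = firstLetters τ (ℓ n) ++ T.out ⟨s n, n, rfl⟩ (σ n) := by
    have hex : ∃ m, s m = s n ∧ σ m = σ n := ⟨n, rfl, rfl⟩
    obtain ⟨h1, L, h2, h3, h4⟩ := h.step _ n hex.choose_spec.1 hex.choose_spec.2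
    refine ⟨by simp only [T, dif_pos hex, h1], ?_⟩
    simp only [T, dif_pos hex, h2, h3, Nat.add_sub_cancel_left, firstLetters_add]
    rw [firstLetters_congr h4]
  have key2 (n : ℕ) : (T.stateAt σ n).1 = s n ∧
      T.output T.start (firstLetters σ n) = firstLetters τ (ℓ n) := by
    induction n with
    | zero => exact ⟨rfl, by rw [h.zero]; rfl⟩
    | succ n ih =>
      have e : T.stateAt σ n = ⟨s n, n, rfl⟩ := Subtype.ext ih.1
      rw [T.stateAt_succ, T.output_succ, e, ih.2]
      exact ⟨(key n).1, (key n).2.symm⟩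
  refine ⟨T, fun n => by rw [(key2 n).2, length_firstLetters], ?_⟩
  simpa only [(key2 _).2, length_firstLetters] using h.tendsto

namespace IsRun

variable {S : Type*} {σ τ : ℕ → Bool} {s : ℕ → S} {ℓ : ℕ → ℕ}

theorem le_succ (h : IsRun σ τ s ℓ) (n : ℕ) : ℓ n ≤ ℓ (n + 1) := by
  obtain ⟨-, L, h2, -⟩ := h.step n n rfl rfl
  omega

theorem mono (h : IsRun σ τ s ℓ) : Monotone ℓ := monotone_nat_of_le_succ h.le_succ

/-- Two parts of a run that begin in the same state and read the same word. -/
theorem parallel (h : IsRun σ τ s ℓ) {m n : ℕ} (hs : s m = s n) (k : ℕ)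
    (hσ : ∀ i < k, σ (m + i) = σ (n + i)) : s (m + k) = s (n + k) ∧
    ∃ L, ℓ (m + k) = ℓ m + L ∧ ℓ (n + k) = ℓ n + L ∧ ∀ i < L, τ (ℓ m + i) = τ (ℓ n + i) := by
  induction k with
  | zero => exact ⟨hs, 0, rfl, rfl, by simp⟩
  | succ k ih =>
    obtain ⟨h1, L, h2, h3, h4⟩ := ih fun i hi => hσ i (by omega)
    obtain ⟨h5, L', h6, h7, h8⟩ := h.step _ _ h1 (hσ k (by omega))
    refine ⟨h5, L + L', by rw [← add_assoc]; omega, by rw [← add_assoc]; omega, fun i hi => ?_⟩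
    rcases lt_or_ge i L with hL | hL
    · exact h4 i hL
    · have := h8 (i - L) (by omega)
      rwa [h2, h3, add_assoc, add_assoc, Nat.add_sub_cancel' hL] at this

theorem trans {S' : Type*} {ρ : ℕ → Bool} {s' : ℕ → S'} {ℓ' : ℕ → ℕ} (h : IsRun σ τ s ℓ)
    (h' : IsRun τ ρ s' ℓ') : IsRun σ ρ (fun n => (s n, s' (ℓ n))) fun n => ℓ' (ℓ n) where
  zero := by rw [h.zero, h'.zero]
  tendsto := h'.tendsto.comp h.tendsto
  step m n hs hσ := by
    obtain ⟨h0, h0'⟩ := Prod.mk.inj hs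
    obtain ⟨h1, L, h2, h3, h4⟩ := h.step m n h0 hσ
    rw [h1, h2, h3]
    obtain ⟨h5, h6⟩ := h'.parallel h0' L h4
    exact ⟨by rw [h5], h6⟩

end IsRun

theorem Reduces.exists_isRun {σ τ : ℕ → Bool} (h : Reduces σ τ) :
    ∃ (S : Type) (_ : Finite S) (next : S → Bool → S) (s : ℕ → S) (ℓ : ℕ → ℕ),
      IsRun σ τ s ℓ ∧ ∀ n, s (n + 1) = next (s n) (σ n) := by
  obtain ⟨T, hT⟩ := h
  exact ⟨T.State, T.finite_state, T.next, _, _, hT.isRun, T.stateAt_succ σ⟩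

theorem Reduces.trans {σ τ ρ : ℕ → Bool} (h : Reduces σ τ) (h' : Reduces τ ρ) : Reduces σ ρ := by
  obtain ⟨S, _, -, s, ℓ, hr, -⟩ := h.exists_isRun
  obtain ⟨S', _, -, s', ℓ', hr', -⟩ := h'.exists_isRun
  exact .of_isRun (hr.trans hr') (Set.toFinite _)

/-! ### Equivalences and ultimately periodic sequences -/

theorem Equivalent.symm {σ τ : ℕ → Bool} (h : Equivalent σ τ) : Equivalent τ σ := ⟨h.2, h.1⟩

theorem Equivalent.trans {σ τ ρ : ℕ → Bool} (h : Equivalent σ τ) (h' : Equivalent τ ρ) :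
    Equivalent σ ρ := ⟨h.1.trans h'.1, h'.2.trans h.2⟩

/-- A synchronous transduction that adds a prediction made by the state is invertible. -/
theorem Equivalent.of_prediction {S : Type} {σ τ : ℕ → Bool} (s : ℕ → S)
    (hfin : (Set.range s).Finite) (pred : S → Bool)
    (hs : ∀ m n, s m = s n → σ m = σ n → s (m + 1) = s (n + 1))
    (hτ : ∀ n, τ n = (σ n ^^ pred (s n))) : Equivalent σ τ := by
  constructor
  · refine .of_isRun (s := s) (ℓ := id) ⟨rfl, tendsto_id, fun m n h1 h2 => ⟨hs m n h1 h2, 1, rfl,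
      rfl, fun i hi => ?_⟩⟩ hfin
    obtain rfl : i = 0 := by omega
    simp [hτ, h1, h2]
  · refine .of_isRun (s := s) (ℓ := id) ⟨rfl, tendsto_id, fun m n h1 h2 => ?_⟩ hfin
    have h3 : σ m = σ n := by simpa [hτ, h1] using h2
    refine ⟨hs m n h1 h3, 1, rfl, rfl, fun i hi => ?_⟩
    obtain rfl : i = 0 := by omega
    simpa using h3

theorem equivalent_drop (σ : ℕ → Bool) (k : ℕ) : Equivalent σ fun n => σ (k + n) := by
  constructor
  · refine .of_isRun (s := fun n => min n k) (ℓ := fun n => n - k) ⟨by simp,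
      tendsto_sub_atTop_nat k, fun m n h1 h2 => ?_⟩
      ((Set.finite_Iic k).subset (by rintro _ ⟨n, rfl⟩; exact Nat.min_le_right n k))
    refine ⟨by omega, if m < k then 0 else 1, by split <;> omega, by split <;> omega,
      fun i hi => ?_⟩
    split_ifs at hi with h3
    · omega
    · obtain rfl : i = 0 := by omega
      simpa [Nat.add_sub_cancel' (show k ≤ m by omega), Nat.add_sub_cancel' (show k ≤ n by omega)]
  -- The missing `k` letters are written together with the first letter.
  · refine .of_isRun (s := fun n => decide (n = 0)) (ℓ := fun n => if n = 0 then 0 else k + n)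
      ⟨rfl, ?_, fun m n h1 h2 => ?_⟩ (Set.toFinite _)
    · refine tendsto_atTop_mono (fun n => ?_) tendsto_id
      dsimp only [id]
      split_ifs <;> omega
    · have h1 : m = 0 ↔ n = 0 := by simpa using h1
      by_cases h : n = 0
      · obtain rfl := h
        obtain rfl := h1.2 rfl
        exact ⟨by simp, k + 1, by simp, by simp, by simp⟩
      · have h' := mt h1.1 h
        refine ⟨by simp, 1, by simp [h']; ring, by simp [h]; ring, fun i hi => ?_⟩
        obtain rfl : i = 0 := by omega
        simpa [h, h'] using h2

theorem UltimatelyPeriodic.finite_range_drop {A : Type*} {σ : ℕ → A} (h : UltimatelyPeriodic σ) :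
    (Set.range fun n i => σ (n + i)).Finite := by
  obtain ⟨N, p, hp, h⟩ := h
  refine ((Set.finite_Iio (N + p)).image fun n i => σ (n + i)).subset ?_
  rintro _ ⟨n, rfl⟩
  induction n using Nat.strong_induction_on with
  | _ n ih =>
    rcases lt_or_ge n (N + p) with hn | hn
    · exact ⟨n, hn, rfl⟩
    · obtain ⟨m, hm, hm'⟩ := ih (n - p) (by omega)
      refine ⟨m, hm, hm'.trans ?_⟩
      funext i
      dsimp only
      rw [← h _ (by omega)]
      congr 1
      omega

/-- The state is the whole remaining tail of `σ`; only finitely many tails occur, and the input is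
ignored. -/
theorem UltimatelyPeriodic.reduces {σ : ℕ → Bool} (h : UltimatelyPeriodic σ) (τ : ℕ → Bool) :
    Reduces τ σ := by
  refine .of_isRun (s := fun n i => σ (n + i)) (ℓ := id) ⟨rfl, tendsto_id, fun m n h1 h2 =>
    ⟨?_, 1, rfl, rfl, fun i hi => congrFun h1 i⟩⟩ h.finite_range_drop
  funext i
  have := congrFun h1 (1 + i)
  simpa only [← add_assoc] using this

/-! ### The blocks of `⟨g⟩` -/

/-- The position at which block `n` of `⟨g⟩` begins. -/
def blockPos (g : ℕ → ℕ) (n : ℕ) : ℕ := ∑ i ∈ Finset.range n, (g i + 1)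

@[simp] theorem blockPos_zero (g : ℕ → ℕ) : blockPos g 0 = 0 := rfl

theorem blockPos_succ (g : ℕ → ℕ) (n : ℕ) : blockPos g (n + 1) = blockPos g n + (g n + 1) :=
  Finset.sum_range_succ _ _

theorem blockPos_strictMono (g : ℕ → ℕ) : StrictMono (blockPos g) :=
  strictMono_nat_of_lt_succ fun n => by rw [blockPos_succ]; omega

theorem blockPos_add (g : ℕ → ℕ) (k n : ℕ) :
    blockPos g (k + n) = blockPos g k + blockPos (shift k g) n := by
  simp [blockPos, Finset.sum_range_add, shift, add_comm]

theorem blockWord_succ (g : ℕ → ℕ) (n : ℕ) :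
    blockWord g (n + 1) = blockWord g n ++ (true :: List.replicate (g n) false) := by
  simp [blockWord, List.range_succ]

theorem length_blockWord (g : ℕ → ℕ) (n : ℕ) : (blockWord g n).length = blockPos g n := by
  induction n with
  | zero => rfl
  | succ n ih => simp [blockWord_succ, blockPos_succ, ih]

theorem blockWord_prefix (g : ℕ → ℕ) {m n : ℕ} (h : m ≤ n) : blockWord g m <+: blockWord g n := by
  induction n, h using Nat.le_induction with
  | base => exact List.prefix_rfl
  | succ n _ ih => exact ih.trans ⟨_, (blockWord_succ g n).symm⟩

theorem getElem?_blockWord (g : ℕ → ℕ) {n x : ℕ} (h : x < blockPos g n) :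
    (blockWord g n)[x]? = some (blockSeq g x) := by
  have h1 : x < (blockWord g (x + 1)).length := le_length_blockWord g (x + 1)
  rw [blockSeq, ← List.getElem?_eq_getElem h1]
  rw [← length_blockWord] at h
  rcases le_total n (x + 1) with h2 | h2
  · obtain ⟨t, ht⟩ := blockWord_prefix g h2
    rw [← ht, List.getElem?_append_left h]
  · obtain ⟨t, ht⟩ := blockWord_prefix g h2
    rw [← ht, List.getElem?_append_left h1]

theorem blockSeq_blockPos_add (g : ℕ → ℕ) {n z : ℕ} (h : z ≤ g n) :
    blockSeq g (blockPos g n + z) = decide (z = 0) := by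
  have h1 : blockPos g n + z < blockPos g (n + 1) := by rw [blockPos_succ]; omega
  have h2 := getElem?_blockWord g h1
  rw [blockWord_succ, ← length_blockWord, List.getElem?_append_right (by omega),
    Nat.add_sub_cancel_left] at h2
  rw [length_blockWord] at h2
  cases z with
  | zero => simpa using h2.symm
  | succ z => simpa [List.getElem?_replicate, show z < g n by omega] using h2.symm

theorem exists_blockPos_add (g : ℕ → ℕ) (x : ℕ) : ∃ n z, z ≤ g n ∧ x = blockPos g n + z := by
  induction x with
  | zero => exact ⟨0, 0, Nat.zero_le _, rfl⟩
  | succ x ih =>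
    obtain ⟨n, z, hz, rfl⟩ := ih
    rcases hz.lt_or_eq with h | rfl
    · exact ⟨n, z + 1, h, rfl⟩
    · exact ⟨n + 1, 0, Nat.zero_le _, by rw [blockPos_succ]; omega⟩

theorem eq_of_mem_Ico_of_strictMono {M : ℕ → ℕ} (hM : StrictMono M) {x a b : ℕ} (h1 : M a ≤ x)
    (h2 : x < M (a + 1)) (h3 : M b ≤ x) (h4 : x < M (b + 1)) : a = b := by
  have h5 := hM.lt_iff_lt.1 (h1.trans_lt h4)
  have h6 := hM.lt_iff_lt.1 (h3.trans_lt h2)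
  omega

theorem blockPos_add_inj {g : ℕ → ℕ} {m n y z : ℕ} (hy : y ≤ g m) (hz : z ≤ g n)
    (h : blockPos g m + y = blockPos g n + z) : m = n ∧ y = z := by
  have h1 := blockPos_succ g m
  have h2 := blockPos_succ g n
  obtain rfl := eq_of_mem_Ico_of_strictMono (blockPos_strictMono g) (x := blockPos g m + y)
    (a := m) (b := n) (by omega) (by omega) (by omega) (by omega)
  exact ⟨rfl, by omega⟩

/-- The block `N x` containing the position `x`, and the place `Z x` of `x` in this block. -/
theorem exists_blockIndex (g : ℕ → ℕ) : ∃ N Z : ℕ → ℕ, (∀ x, Z x ≤ g (N x)) ∧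
    (∀ x, x = blockPos g (N x) + Z x) ∧
    (∀ x, Z x < g (N x) → N (x + 1) = N x ∧ Z (x + 1) = Z x + 1) ∧
    (∀ x, Z x = g (N x) → N (x + 1) = N x + 1 ∧ Z (x + 1) = 0) ∧
    ∀ x, blockSeq g (x + 1) = true ↔ Z x = g (N x) := by
  choose N Z hZ hNZ using exists_blockPos_add g
  have hlt (x : ℕ) (hx : Z x < g (N x)) : N (x + 1) = N x ∧ Z (x + 1) = Z x + 1 := by
    refine blockPos_add_inj (hZ _) hx ?_
    rw [← hNZ, ← add_assoc, ← hNZ]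
  have heq (x : ℕ) (hx : Z x = g (N x)) : N (x + 1) = N x + 1 ∧ Z (x + 1) = 0 := by
    refine blockPos_add_inj (hZ _) (Nat.zero_le _) ?_
    have := hNZ x
    rw [← hNZ, blockPos_succ]
    omega
  refine ⟨N, Z, hZ, hNZ, hlt, heq, fun x => ?_⟩
  have h1 := blockSeq_blockPos_add g (hZ (x + 1))
  rw [← hNZ] at h1
  rw [h1]
  rcases (hZ x).lt_or_eq with hx | hx
  · simp [hlt x hx, hx.ne]
  · simp [heq x hx, hx]

theorem blockSeq_shift (f : ℕ → ℕ) (k : ℕ) :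
    blockSeq (shift k f) = fun x => blockSeq f (blockPos f k + x) := by
  funext x
  obtain ⟨n, z, hz, rfl⟩ := exists_blockPos_add (shift k f) x
  rw [blockSeq_blockPos_add _ hz, ← add_assoc, ← blockPos_add, blockSeq_blockPos_add]
  rwa [add_comm]

theorem blockSeq_equivalent_shift (f : ℕ → ℕ) (k : ℕ) :
    Equivalent (blockSeq f) (blockSeq (shift k f)) := by
  rw [blockSeq_shift]
  exact equivalent_drop _ _

/-! ### Weighted products as cyclic sums -/

/-- The value of a weighted product, for a tuple given as one period of a sequence of weights. -/
theorem weightedProduct_map_range (a : ℕ → Weight) (m : ℕ) (ha : ∀ n, a (n + (m + 1)) = a n)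
    (f : ℕ → ℕ) (n : ℕ) : weightedProduct ((List.range (m + 1)).map a) f n =
      (a n).apply (shift (∑ i ∈ Finset.range n, (a i).coeffs.length) f) := by
  induction n generalizing a f with
  | zero => simp [List.range_succ_eq_map, weightedProduct]; rfl
  | succ n ih =>
    have h1 : (List.range (m + 1)).map a = a 0 :: (List.range m).map fun i => a (i + 1) := by
      simp [List.range_succ_eq_map]
    have h2 : (List.range m).map (fun i => a (i + 1)) ++ [a 0] =
        (List.range (m + 1)).map fun i => a (i + 1) := by
      have := ha 0
      rw [zero_add] at this
      simp [List.range_succ, this]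
    rw [h1, weightedProduct, h2, ih _ fun n => by rw [← ha (n + 1)]; congr 1; ring,
      Finset.sum_range_succ']
    congr 1
    funext i
    simp [shift, add_assoc]

theorem weight_apply_mk (c : ℕ → ℚ) (K : ℕ) (b : ℚ) (h) (f : ℕ → ℕ) :
    (Weight.mk ((List.range K).map c) b h).apply f = (∑ i ∈ Finset.range K, c i * f i) + b := by
  rw [Weight.apply, Finset.sum_range]
  congr 1
  refine Fintype.sum_equiv (finCongr (by simp)) _ _ fun i => ?_
  simp

/-- A tuple of weights and its cyclic application, with the coefficients of all weights written
one after the other: those of weight `j` have the indices `K j, …, K (j + 1) - 1`. -/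
structure CyclicWeights (m R : ℕ) (coef cst : ℕ → ℚ) (K : ℕ → ℕ) : Prop where
  pos : 0 < m
  coef_nonneg : ∀ n, 0 ≤ coef n
  coef_add : ∀ n, coef (n + R) = coef n
  cst_add : ∀ j, cst (j + m) = cst j
  zero : K 0 = 0
  le_succ : ∀ j, K j ≤ K (j + 1)
  add : ∀ j, K (j + m) = K j + R

/-- The values of the cyclic application of weights. -/
def cyclicValue (coef cst : ℕ → ℚ) (K f : ℕ → ℕ) (j : ℕ) : ℚ :=
  ∑ i ∈ Finset.Ico (K j) (K (j + 1)), coef i * f i + cst j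

theorem CyclicWeights.exists_weightedProduct {m R : ℕ} {coef cst : ℕ → ℚ} {K : ℕ → ℕ}
    (h : CyclicWeights m R coef cst K) :
    ∃ α : List Weight, α ≠ [] ∧ ∀ f, weightedProduct α f = cyclicValue coef cst K f := by
  obtain ⟨m, rfl⟩ : ∃ m', m = m' + 1 := ⟨m - 1, by have := h.pos; omega⟩
  let a (j : ℕ) : Weight := ⟨(List.range (K (j + 1) - K j)).map fun i => coef (K j + i), cst j, by
    simp only [List.mem_map]
    rintro _ ⟨i, -, rfl⟩
    exact h.coef_nonneg _⟩
  refine ⟨(List.range (m + 1)).map a, by simp, fun f => funext fun n => ?_⟩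
  have hK (n : ℕ) : ∑ i ∈ Finset.range n, (a i).coeffs.length = K n := by
    induction n with
    | zero => simp [h.zero]
    | succ n ih =>
      rw [Finset.sum_range_succ, ih]
      have := h.le_succ n
      simp only [a, List.length_map, List.length_range]
      omega
  rw [weightedProduct_map_range, hK, weight_apply_mk, cyclicValue, Finset.sum_Ico_eq_sum_range]
  · simp [shift, add_comm]
  · intro n
    have h1 : K (n + (m + 1) + 1) = K (n + 1) + R := by
      rw [← h.add (n + 1)]; congr 1; ring
    have h2 := h.add n
    have h3 : K (n + (m + 1) + 1) - K (n + (m + 1)) = K (n + 1) - K n := by omega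
    simp only [a, Weight.mk.injEq]
    refine ⟨?_, h.cst_add n⟩
    rw [h3, h2]
    refine List.map_congr_left fun i _ => ?_
    rw [← h.coef_add (K n + i)]
    congr 1
    ring

/-- Given the widths of the intervals, the interval containing a number. -/
theorem exists_Ico_of_le_succ {K : ℕ → ℕ} (h0 : K 0 = 0) (hK : ∀ n, ∃ j, n < K j) (n : ℕ) :
    ∃ j, K j ≤ n ∧ n < K (j + 1) := by
  classical
  have h1 := Nat.find_spec (hK n)
  obtain ⟨j, hj⟩ : ∃ j, Nat.find (hK n) = j + 1 :=
    Nat.exists_eq_succ_of_ne_zero fun h => by rw [h, h0] at h1; omega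
  exact ⟨j, not_lt.1 (Nat.find_min (hK n) (by omega)), hj ▸ h1⟩

theorem exists_cyclicWeights (α : List Weight) (hα : α ≠ []) :
    ∃ (m R : ℕ) (coef cst : ℕ → ℚ) (K : ℕ → ℕ), CyclicWeights m R coef cst K ∧
      ∀ f, weightedProduct α f = cyclicValue coef cst K f := by
  obtain ⟨m, hm⟩ : ∃ m, α.length = m + 1 :=
    Nat.exists_eq_succ_of_ne_zero (by simpa using hα)
  let a (n : ℕ) : Weight := α[n % (m + 1)]'(by rw [hm]; exact Nat.mod_lt _ (Nat.succ_pos _))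
  have ha (n : ℕ) : a (n + (m + 1)) = a n := by simp [a]
  have hαa : α = (List.range (m + 1)).map a := by
    refine List.ext_getElem (by simp [hm]) fun i h1 h2 => ?_
    simp only [hm] at h1
    simp [a, Nat.mod_eq_of_lt h1]
  let K (n : ℕ) : ℕ := ∑ i ∈ Finset.range n, (a i).coeffs.length
  have hKs (n : ℕ) : K (n + 1) = K n + (a n).coeffs.length :=
    Finset.sum_range_succ (fun i => (a i).coeffs.length) n
  have hKm (n : ℕ) : K (n + (m + 1)) = K n + K (m + 1) := by
    induction n with
    | zero => simp [K]
    | succ n ih => rw [add_right_comm, hKs, hKs, ih, ha]; ring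
  have hmono : Monotone K := monotone_nat_of_le_succ fun n => by rw [hKs]; omega
  have hval (f : ℕ → ℕ) (n : ℕ) : weightedProduct α f n = ∑ i ∈ Finset.range (a n).coeffs.length,
      (a n).coeffs.getD i 0 * f (K n + i) + (a n).const := by
    rw [hαa, weightedProduct_map_range a m ha, Weight.apply,
      Finset.sum_range fun i => (a n).coeffs.getD i 0 * (f (K n + i) : ℚ)]
    congr 1
    refine Finset.sum_congr rfl fun i _ => ?_
    simp [shift, K, add_comm]
  -- When no weight has a coefficient, no index lies in any interval, and the zero coefficient
  -- sequence serves.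
  rcases Nat.eq_zero_or_pos (K (m + 1)) with hR | hR
  · have hK0 (n : ℕ) : K n = 0 := by
      induction n using Nat.strong_induction_on with
      | _ n ih =>
        rcases le_total n (m + 1) with h | h
        · exact Nat.eq_zero_of_le_zero ((hmono h).trans hR.le)
        · obtain ⟨n, rfl⟩ := Nat.exists_eq_add_of_le' h
          rw [hKm, hR, ih n (by omega)]
    refine ⟨m + 1, 0, 0, fun n => (a n).const, K, ⟨Nat.succ_pos _, fun _ => le_rfl, fun _ => rfl,
      fun j => by simp only [ha], hK0 0, fun j => by simp [hK0], fun j => by simp [hK0]⟩,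
      fun f => funext fun n => ?_⟩
    have h := hKs n
    rw [hK0, hK0, zero_add] at h
    simp [hval, cyclicValue, ← h, hK0]
  · have hunb (n : ℕ) : ∃ j, n < K j := by
      have (j : ℕ) : j ≤ K (j * (m + 1)) := by
        induction j with
        | zero => exact Nat.zero_le _
        | succ j ih => rw [add_mul, one_mul, hKm]; omega
      exact ⟨_, this (n + 1)⟩
    choose b hb1 hb2 using exists_Ico_of_le_succ (K := K) rfl hunb
    have hbu {n j : ℕ} (h1 : K j ≤ n) (h2 : n < K (j + 1)) : b n = j := by
      have h3 := hmono.reflect_lt (h1.trans_lt (hb2 n))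
      have h4 := hmono.reflect_lt ((hb1 n).trans_lt h2)
      omega
    refine ⟨m + 1, K (m + 1), fun n => (a (b n)).coeffs.getD (n - K (b n)) 0,
      fun n => (a n).const, K, ⟨Nat.succ_pos _, fun n => ?_, fun n => ?_, fun j => by simp only [ha],
      rfl, fun j => by rw [hKs]; omega, hKm⟩, fun f => funext fun n => ?_⟩
    · have h : n - K (b n) < (a (b n)).coeffs.length := by
        have := hb1 n
        have := hb2 n
        rw [hKs] at this
        omega
      rw [List.getD_eq_getElem _ _ h]
      exact (a (b n)).coeffs_nonneg _ (List.getElem_mem h)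
    · have h1 : b (n + K (m + 1)) = b n + (m + 1) := by
        apply hbu
        · rw [hKm]; have := hb1 n; omega
        · rw [add_right_comm, hKm]; have := hb2 n; omega
      rw [h1, ha, hKm, Nat.add_sub_add_right]
    · rw [hval, cyclicValue, Finset.sum_Ico_eq_sum_range, hKs, Nat.add_sub_cancel_left]
      congr 1
      refine Finset.sum_congr rfl fun i hi => ?_
      rw [Finset.mem_range] at hi
      rw [hbu (j := n) (by omega) (by rw [hKs]; omega), Nat.add_sub_cancel_left]

/-! ### From weights to transducts -/

theorem blockPos_congr {g₁ g₂ : ℕ → ℕ} {c : ℕ} (h : ∀ i < c, g₁ i = g₂ i) :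
    blockPos g₁ c = blockPos g₂ c :=
  Finset.sum_congr rfl fun i hi => by rw [h i (Finset.mem_range.1 hi)]

theorem blockSeq_congr {g₁ g₂ : ℕ → ℕ} {c e : ℕ} (h : ∀ i < c, g₁ i = g₂ i) (h₁ : e ≤ g₁ c)
    (h₂ : e ≤ g₂ c) {x : ℕ} (hx : x ≤ blockPos g₁ c + e) : blockSeq g₁ x = blockSeq g₂ x := by
  obtain ⟨n, z, hz, rfl⟩ := exists_blockPos_add g₁ x
  have hn : n ≤ c := by
    by_contra! hn
    have := (blockPos_strictMono g₁).monotone hn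
    rw [Nat.succ_eq_add_one, blockPos_succ] at this
    omega
  have hz' : z ≤ g₂ n := by
    rcases hn.lt_or_eq with hn | rfl
    · rwa [← h n hn]
    · omega
  rw [blockSeq_blockPos_add g₁ hz, blockPos_congr fun i hi => h i (hi.trans_le hn),
    blockSeq_blockPos_add g₂ hz']

theorem blockSeq_ultimatelyPeriodic {g : ℕ → ℕ} {m : ℕ} (hm : 0 < m)
    (h : ∀ n, g (n + m) = g n) : UltimatelyPeriodic (blockSeq g) := by
  refine ⟨0, blockPos g m, (blockPos_strictMono g).le_apply.trans_lt' hm, fun n _ => ?_⟩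
  have h1 := congrFun (blockSeq_shift g m) n
  rw [show shift m g = g from funext h] at h1
  rw [h1, add_comm]

/-- The number of new zeros depends on the remainder `v - ⌊v⌋₊` alone. The natural floor of a
negative `v` is `0`, so its remainder is `v` itself, a debt still to be paid off. -/
theorem floor_add_of_nonneg {v c : ℚ} (hc : 0 ≤ c) :
    ⌊v + c⌋₊ = ⌊v⌋₊ + ⌊v - ⌊v⌋₊ + c⌋₊ := by
  rcases lt_or_ge v 0 with hv | hv
  · simp [Nat.floor_of_nonpos hv.le]
  · have h : 0 ≤ v - ⌊v⌋₊ + c := add_nonneg (sub_nonneg.2 (Nat.floor_le hv)) hc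
    rw [add_comm ⌊v⌋₊, ← Nat.floor_add_natCast h]
    congr 1
    ring

theorem exists_common_denominator {u : ℕ → ℚ} {m : ℕ} (hm : 0 < m) (hu : ∀ n, u (n + m) = u n) :
    ∃ D : ℕ, 0 < D ∧ ∀ n, ∃ z : ℤ, D * u n = z := by
  refine ⟨∏ i ∈ Finset.range m, (u i).den, Finset.prod_pos fun i _ => (u i).den_pos, fun n => ?_⟩
  rw [← (show Function.Periodic u m from hu).map_mod_nat n]
  obtain ⟨e, he⟩ := Finset.dvd_prod_of_mem (fun i => (u i).den)
    (Finset.mem_range.2 (Nat.mod_lt n hm))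
  refine ⟨e * (u (n % m)).num, ?_⟩
  rw [he]
  push_cast
  rw [← Rat.den_mul_eq_num]
  ring

theorem exists_lower_bound {u : ℕ → ℚ} {m : ℕ} (hm : 0 < m) (hu : ∀ n, u (n + m) = u n) :
    ∃ C : ℕ, ∀ n, -(C : ℚ) ≤ u n := by
  obtain ⟨C, hC⟩ := exists_nat_ge (∑ i ∈ Finset.range m, |u i|)
  refine ⟨C, fun n => ?_⟩
  rw [← (show Function.Periodic u m from hu).map_mod_nat n]
  have h1 := Finset.single_le_sum (f := fun i => |u i|) (fun i _ => abs_nonneg _)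
    (Finset.mem_range.2 (Nat.mod_lt n hm))
  exact (abs_le.1 (h1.trans hC)).1

/-- Bounds the remainders that the transducer must store; `C` bounds the debt from negative
constants. -/
theorem finite_setOf_bounded_fractions {D : ℕ} (hD : 0 < D) (C : ℕ) :
    {t : ℚ | (∃ z : ℤ, D * t = z) ∧ -(C : ℚ) ≤ t ∧ t ≤ 1}.Finite := by
  refine ((Set.finite_Icc (-(D * C) : ℤ) D).image fun z : ℤ => (z : ℚ) / D).subset ?_
  rintro t ⟨⟨z, hz⟩, h1, h2⟩
  have hD' : (0 : ℚ) < D := by exact_mod_cast hD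
  refine ⟨z, ⟨?_, ?_⟩, by simp only [← hz]; field_simp⟩
  · have : -((D : ℚ) * C) ≤ z := by rw [← hz]; nlinarith
    exact_mod_cast this
  · have : (z : ℚ) ≤ D := by rw [← hz]; nlinarith
    exact_mod_cast this

/-- The partial value of a weight: the weight of index `j` has been applied to the arguments with
index less than `n` and to `z` of the units of the argument with index `n`. -/
def partialValue (coef cst : ℕ → ℚ) (K f : ℕ → ℕ) (j n z : ℕ) : ℚ :=
  cst j + ∑ i ∈ Finset.Ico (K j) n, coef i * f i + coef n * z

theorem exists_int_partialValue {coef cst : ℕ → ℚ} {D₁ D₂ : ℕ}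
    (h₁ : ∀ n, ∃ z : ℤ, D₁ * coef n = z) (h₂ : ∀ n, ∃ z : ℤ, D₂ * cst n = z) (K f : ℕ → ℕ)
    (j n z : ℕ) : ∃ y : ℤ, ((D₁ * D₂ : ℕ) : ℚ) * partialValue coef cst K f j n z = y := by
  choose u hu using h₁
  choose w hw using h₂
  refine ⟨D₁ * w j + D₂ * ∑ i ∈ Finset.Ico (K j) n, u i * f i + D₂ * u n * z, ?_⟩
  have e : D₁ * ∑ i ∈ Finset.Ico (K j) n, coef i * f i =
      ∑ i ∈ Finset.Ico (K j) n, (u i : ℚ) * f i := by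
    rw [Finset.mul_sum]
    exact Finset.sum_congr rfl fun i _ => by rw [← hu]; ring
  push_cast
  rw [partialValue, ← e, ← hu, ← hw]
  ring

namespace CyclicWeights

variable {m R : ℕ} {coef cst : ℕ → ℚ} {K : ℕ → ℕ}

theorem mono (h : CyclicWeights m R coef cst K) : Monotone K := monotone_nat_of_le_succ h.le_succ

theorem coef_add_mul (h : CyclicWeights m R coef cst K) (n t : ℕ) :
    coef (n + t * R) = coef n := by
  simpa using Function.Periodic.nat_mul (show Function.Periodic coef R from h.coef_add) t n

theorem cst_add_mul (h : CyclicWeights m R coef cst K) (n t : ℕ) :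
    cst (n + t * m) = cst n := by
  simpa using Function.Periodic.nat_mul (show Function.Periodic cst m from h.cst_add) t n

theorem add_mul (h : CyclicWeights m R coef cst K) (j t : ℕ) : K (j + t * m) = K j + t * R := by
  induction t with
  | zero => simp
  | succ t ih => rw [_root_.add_mul, one_mul, ← add_assoc, h.add, ih]; ring

theorem exists_lt (h : CyclicWeights m R coef cst K) (hR : 0 < R) (n : ℕ) : ∃ j, n < K j := by
  refine ⟨0 + (n + 1) * m, ?_⟩
  rw [h.add_mul]
  nlinarith

theorem index_unique (h : CyclicWeights m R coef cst K) {n i j : ℕ} (h1 : K i ≤ n)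
    (h2 : n < K (i + 1)) (h3 : K j ≤ n) (h4 : n < K (j + 1)) : i = j := by
  have h5 := h.mono.reflect_lt (h1.trans_lt h4)
  have h6 := h.mono.reflect_lt (h3.trans_lt h2)
  omega

theorem partialValue_le (h : CyclicWeights m R coef cst K) (f : ℕ → ℕ) {j n z : ℕ}
    (h1 : K j ≤ n) (h2 : n < K (j + 1)) (hz : z ≤ f n) :
    partialValue coef cst K f j n z ≤ cyclicValue coef cst K f j := by
  have h3 : ∑ i ∈ Finset.Ico (K j) (n + 1), coef i * (f i : ℚ) ≤
      ∑ i ∈ Finset.Ico (K j) (K (j + 1)), coef i * (f i : ℚ) :=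
    Finset.sum_le_sum_of_subset_of_nonneg (Finset.Ico_subset_Ico_right h2) fun i _ _ =>
      mul_nonneg (h.coef_nonneg i) (Nat.cast_nonneg _)
  rw [Finset.sum_Ico_succ_top h1] at h3
  have h4 : coef n * z ≤ coef n * f n :=
    mul_le_mul_of_nonneg_left (by exact_mod_cast hz) (h.coef_nonneg n)
  rw [partialValue, cyclicValue]
  linarith

theorem le_partialValue (h : CyclicWeights m R coef cst K) (f : ℕ → ℕ) (j n z : ℕ) :
    cst j ≤ partialValue coef cst K f j n z := by
  have h1 : 0 ≤ ∑ i ∈ Finset.Ico (K j) n, coef i * (f i : ℚ) :=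
    Finset.sum_nonneg fun i _ => mul_nonneg (h.coef_nonneg i) (Nat.cast_nonneg _)
  have h2 : 0 ≤ coef n * z := mul_nonneg (h.coef_nonneg n) (Nat.cast_nonneg _)
  rw [partialValue]
  linarith

theorem partialValue_add_one (f : ℕ → ℕ) (j n z : ℕ) :
    partialValue coef cst K f j n (z + 1) = partialValue coef cst K f j n z + coef n := by
  rw [partialValue, partialValue]
  push_cast
  ring

theorem partialValue_next (f : ℕ → ℕ) {j n : ℕ} (h : K j ≤ n) :
    partialValue coef cst K f j (n + 1) 0 = partialValue coef cst K f j n (f n) := by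
  rw [partialValue, partialValue, Finset.sum_Ico_succ_top h]
  push_cast
  ring

theorem partialValue_last (f : ℕ → ℕ) {j n : ℕ} (h : K j ≤ n) (h' : n + 1 = K (j + 1)) :
    partialValue coef cst K f j n (f n) = cyclicValue coef cst K f j := by
  rw [← partialValue_next f h, partialValue, cyclicValue, h']
  push_cast
  ring

/-- `⟨f⟩` is transduced to the sequence of the values of the cyclic application of weights to
`f`. -/
theorem reduces_of_pos (h : CyclicWeights m R coef cst K) (hR : 0 < R) {f g : ℕ → ℕ}
    (hg : ∀ j, cyclicValue coef cst K f j = g j) : Reduces (blockSeq f) (blockSeq g) := by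
  choose b hb1 hb2 using exists_Ico_of_le_succ h.zero (h.exists_lt hR)
  obtain ⟨N, Z, hZ, hNZ, hlt, heq, hletter⟩ := exists_blockIndex f
  let val (n z : ℕ) : ℚ := partialValue coef cst K f (b n) n z
  have hbadd (n t : ℕ) : b (n + t * R) = b n + t * m := by
    refine h.index_unique (hb1 _) (hb2 _) ?_ ?_
    · rw [h.add_mul]; have := hb1 n; omega
    · rw [add_right_comm, h.add_mul]; have := hb2 n; omega
  have hval {n z : ℕ} (hz : z ≤ f n) : ⌊val n z⌋₊ ≤ g (b n) := by
    have := h.partialValue_le f (hb1 n) (hb2 n) hz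
    rw [hg] at this
    exact Nat.floor_le_of_le this
  -- After reading the letter at `x`, all blocks of `g` before the current one are complete, and the
  -- current one has its 1 and as many zeros as the integer part of the partial value.
  let ℓ : ℕ → ℕ
    | 0 => 0
    | x + 1 => blockPos g (b (N x)) + 1 + ⌊val (N x) (Z x)⌋₊
  let s : ℕ → Option (ℕ × ℚ)
    | 0 => none
    | x + 1 => some (N x % R, val (N x) (Z x) - ⌊val (N x) (Z x)⌋₊)
  have hfin : (Set.range s).Finite := by
    obtain ⟨D₁, hD₁, h₁⟩ := exists_common_denominator hR h.coef_add
    obtain ⟨D₂, hD₂, h₂⟩ := exists_common_denominator h.pos h.cst_add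
    obtain ⟨C, hC⟩ := exists_lower_bound h.pos h.cst_add
    refine ((((Set.finite_Iio R).prod (finite_setOf_bounded_fractions
      (Nat.mul_pos hD₁ hD₂) C)).image some).insert none).subset ?_
    rintro _ ⟨_ | x, rfl⟩
    · exact Or.inl rfl
    · refine Or.inr ⟨_, ⟨Nat.mod_lt _ hR, ?_, ?_, ?_⟩, rfl⟩
      · obtain ⟨y, hy⟩ := exists_int_partialValue h₁ h₂ K f (b (N x)) (N x) (Z x)
        refine ⟨y - (D₁ * D₂ : ℕ) * ⌊val (N x) (Z x)⌋₊, ?_⟩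
        rw [mul_sub, hy]
        push_cast
        ring
      · rcases lt_or_ge (val (N x) (Z x)) 0 with hv | hv
        · rw [Nat.floor_of_nonpos hv.le]
          simpa using (hC _).trans (h.le_partialValue f _ _ _)
        · have := Nat.floor_le hv
          have : (0 : ℚ) ≤ C := Nat.cast_nonneg _
          linarith
      · have := Nat.lt_floor_add_one (val (N x) (Z x))
        linarith
  refine .of_isRun (s := s) (ℓ := ℓ) ⟨rfl, ?_, ?_⟩ hfin
  · refine tendsto_atTop.2 fun B => ?_
    filter_upwards [eventually_ge_atTop (blockPos f (K B) + 1)] with x hx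
    obtain ⟨x, rfl⟩ := Nat.exists_eq_add_of_le' ((Nat.le_add_left 1 _).trans hx)
    have h1 : K B ≤ N x := by
      have h1 := hNZ x
      have h2 := hZ x
      have h3 := blockPos_succ f (N x)
      have := (blockPos_strictMono f).lt_iff_lt.1
        (show blockPos f (K B) < blockPos f (N x + 1) by omega)
      omega
    have h2 : B ≤ b (N x) := by
      have := h.mono.reflect_lt (h1.trans_lt (hb2 (N x)))
      omega
    have h3 : b (N x) ≤ blockPos g (b (N x)) := (blockPos_strictMono g).le_apply
    simp only [ℓ]
    omega
  · rintro (_ | x) (_ | y) hs hσ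
    · exact ⟨rfl, ℓ 1, by simp [ℓ], by simp [ℓ], fun _ _ => rfl⟩
    · simp [s] at hs
    · simp [s] at hs
    simp only [s, Option.some.injEq, Prod.mk.injEq] at hs
    obtain ⟨hmod, ht⟩ := hs
    have hxR : N x = N x % R + N x / R * R := (Nat.mod_add_div' _ _).symm
    have hyR : N y = N x % R + N y / R * R := by rw [hmod]; exact (Nat.mod_add_div' _ _).symm
    generalize N x % R = n at hxR hyR
    generalize N x / R = t at hxR
    generalize N y / R = t' at hyR
    have hcoef : coef (N x) = coef (N y) := by
      rw [hxR, hyR, h.coef_add_mul, h.coef_add_mul]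
    -- Case distinction on the next letter: a 0 continues the block of `f`, a 1 starts a new one.
    rcases (hZ x).lt_or_eq with hx | hx
    · have hy : Z y < f (N y) := by
        refine (hZ y).lt_of_ne fun hy => hx.ne ?_
        rwa [← hletter, hσ, hletter]
      obtain ⟨hx1, hx2⟩ := hlt x hx
      obtain ⟨hy1, hy2⟩ := hlt y hy
      have key {x : ℕ} (hx1 : N (x + 1) = N x) (hx2 : Z (x + 1) = Z x + 1) :
          val (N (x + 1)) (Z (x + 1)) = val (N x) (Z x) + coef (N x) := by
        rw [hx1, hx2]; exact partialValue_add_one f _ _ _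
      have fl {x : ℕ} := floor_add_of_nonneg (v := val (N x) (Z x)) (h.coef_nonneg (N x))
      have hle {x : ℕ} (hx1 : N (x + 1) = N x) (hx2 : Z (x + 1) = Z x + 1) :
          ⌊val (N x) (Z x) + coef (N x)⌋₊ ≤ g (b (N x)) := by
        rw [← key hx1 hx2, hx1]; exact hval (hx1 ▸ hZ (x + 1))
      refine ⟨?_, ⌊val (N x) (Z x) - ⌊val (N x) (Z x)⌋₊ + coef (N x)⌋₊, ?_, ?_, fun i hi => ?_⟩
      · simp only [s]
        rw [key hx1 hx2, key hy1 hy2, fl, fl, hx1, hy1, hmod, hcoef]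
        push_cast
        rw [ht]
        congr 2
        linarith
      · simp only [ℓ]
        rw [key hx1 hx2, fl, hx1]
        ring
      · simp only [ℓ]
        rw [key hy1 hy2, fl, hy1, ht, hcoef]
        ring
      · have h1 := hle hx1 hx2
        have h2 := hle hy1 hy2
        rw [fl] at h1 h2
        have h3 := hi
        rw [ht, hcoef] at h3
        simp only [ℓ]
        rw [add_assoc, add_assoc, add_assoc, add_assoc, blockSeq_blockPos_add, blockSeq_blockPos_add]
        · simp
        · omega
        · omega
    · have hy : Z y = f (N y) := by rwa [← hletter, ← hσ, hletter]
      obtain ⟨hx1, hx2⟩ := heq x hx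
      obtain ⟨hy1, hy2⟩ := heq y hy
      have hmod' : N (x + 1) % R = N (y + 1) % R := by
        rw [hx1, hy1, Nat.add_mod, hmod, ← Nat.add_mod]
      -- Either the next argument belongs to the same weight and nothing is written, or the weight
      -- is finished.
      by_cases hn : n + 1 < K (b n + 1)
      · have key {x t : ℕ} (hxR : N x = n + t * R) (hx : Z x = f (N x))
            (hx1 : N (x + 1) = N x + 1) (hx2 : Z (x + 1) = 0) :
            b (N (x + 1)) = b (N x) ∧ val (N (x + 1)) (Z (x + 1)) = val (N x) (Z x) := by
          have h1 : b (N (x + 1)) = b (N x) := by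
            refine h.index_unique (hb1 _) (hb2 _) ?_ ?_
            · have := hb1 (N x); omega
            · rw [hx1, hxR, hbadd, add_right_comm (b n), h.add_mul]; omega
          refine ⟨h1, ?_⟩
          simp only [val]
          rw [h1, hx1, hx2, hx]
          exact partialValue_next f (hb1 _)
        obtain ⟨hx3, hx4⟩ := key hxR hx hx1 hx2
        obtain ⟨hy3, hy4⟩ := key hyR hy hy1 hy2
        refine ⟨?_, 0, ?_, ?_, by simp⟩
        · simp only [s]
          rw [hx4, hy4, hmod', ht]
        · simp only [ℓ]
          rw [hx4, hx3]
          rfl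
        · simp only [ℓ]
          rw [hy4, hy3]
          rfl
      · have hn' : n + 1 = K (b n + 1) := by have := hb2 n; omega
        -- The `c` weights between the finished one and the next one in use have no coefficients:
        -- their values are constants, and their blocks are written at once.
        have hb : b n + 1 ≤ b (n + 1) := by
          have := h.mono.reflect_lt (hn'.symm.le.trans_lt (hb2 (n + 1)))
          omega
        obtain ⟨c, hc⟩ := Nat.exists_eq_add_of_le hb
        have key {x t : ℕ} (hxR : N x = n + t * R) (hx : Z x = f (N x))
            (hx1 : N (x + 1) = N x + 1) (hx2 : Z (x + 1) = 0) :
            val (N (x + 1)) (Z (x + 1)) = cst (b (n + 1)) ∧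
            ℓ (x + 1) = blockPos g (b n + 1 + t * m) ∧
            ℓ (x + 2) = blockPos g (b n + 1 + t * m + c) + 1 + ⌊cst (b (n + 1))⌋₊ ∧
            (∀ i < c, g (b n + 1 + t * m + i) = cst (b n + 1 + i)) ∧
            ⌊cst (b (n + 1))⌋₊ ≤ g (b n + 1 + t * m + c) := by
          have h1 : N (x + 1) = n + 1 + t * R := by rw [hx1, hxR]; ring
          have h2 : K (b (n + 1)) = n + 1 :=
            (hb1 _).antisymm (hn'.le.trans (h.mono hb))
          have h3 : val (N (x + 1)) (Z (x + 1)) = cst (b (n + 1)) := by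
            simp only [val]
            rw [h1, hx2, hbadd, partialValue, h.cst_add_mul, h.add_mul, h2]
            simp
          have h4 : b n + 1 + t * m + c = b (N (x + 1)) := by
            rw [h1, hbadd, hc]; ring
          -- The value of a finished weight is a natural number, so no remainder is lost.
          have h5 : ⌊val (N x) (Z x)⌋₊ = g (b (N x)) := by
            simp only [val]
            rw [hx, partialValue_last f (hb1 _), hg, Nat.floor_natCast]
            rw [hxR, hbadd, add_right_comm (b n), h.add_mul]
            omega
          refine ⟨h3, ?_, ?_, fun i hi => ?_, ?_⟩
          · simp only [ℓ]
            rw [h5, add_right_comm (b n), show b n + t * m = b (N x) by rw [hxR, hbadd],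
              blockPos_succ]
            ring
          · simp only [ℓ]
            rw [h3, h4]
          · have h6 : K (b n + 1 + i) = n + 1 := by
              have h7 := h.mono (show b n + 1 ≤ b n + 1 + i by omega)
              have h8 := h.mono (show b n + 1 + i ≤ b (n + 1) by omega)
              omega
            have h7 : K (b n + 1 + i + 1) = n + 1 := by
              have h7 := h.mono (show b n + 1 ≤ b n + 1 + i + 1 by omega)
              have h8 := h.mono (show b n + 1 + i + 1 ≤ b (n + 1) by omega)
              omega
            rw [← hg, cyclicValue, add_right_comm _ _ i, add_right_comm _ _ 1, h.add_mul,
              h.add_mul, h6, h7, h.cst_add_mul]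
            simp
          · rw [← h3, h4]
            exact hval (hZ _)
        obtain ⟨hx3, hx4, hx5, hx6, hx7⟩ := key hxR hx hx1 hx2
        obtain ⟨hy3, hy4, hy5, hy6, hy7⟩ := key hyR hy hy1 hy2
        have hgg (i : ℕ) (hi : i < c) :
            shift (b n + 1 + t * m) g i = shift (b n + 1 + t' * m) g i := by
          simp only [shift]
          have := (hx6 i hi).trans (hy6 i hi).symm
          rw [add_comm i, add_comm i]
          exact_mod_cast this
        have hpos := blockPos_congr hgg
        refine ⟨?_, blockPos (shift (b n + 1 + t * m) g) c + 1 + ⌊cst (b (n + 1))⌋₊, ?_, ?_,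
          fun i hi => ?_⟩
        · simp only [s]
          rw [hx3, hy3, hmod']
        · rw [hx4, hx5, blockPos_add]; ring
        · rw [hy4, hy5, hpos, blockPos_add]; ring
        · rw [hx4, hy4]
          have h1 := congrFun (blockSeq_shift g (b n + 1 + t * m)) i
          have h2 := congrFun (blockSeq_shift g (b n + 1 + t' * m)) i
          rw [← h1, ← h2]
          refine blockSeq_congr (e := ⌊cst (b (n + 1))⌋₊) hgg ?_ ?_ (by omega)
          · rw [shift, add_comm c]; exact hx7
          · rw [shift, add_comm c]; exact hy7

/-- For `R = 0` only constants occur, so `g` is periodic and needs no input. -/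
theorem reduces (h : CyclicWeights m R coef cst K) {f g : ℕ → ℕ}
    (hg : ∀ j, cyclicValue coef cst K f j = g j) : Reduces (blockSeq f) (blockSeq g) := by
  rcases Nat.eq_zero_or_pos R with rfl | hR
  · refine UltimatelyPeriodic.reduces (blockSeq_ultimatelyPeriodic h.pos fun n => ?_) _
    have h0 (n : ℕ) : K n = 0 := by
      have h1 := h.mono (show n ≤ 0 + n * m by rw [zero_add]; exact Nat.le_mul_of_pos_right n h.pos)
      rw [h.add_mul, h.zero] at h1
      omega
    have h1 := hg (n + m)
    have h2 := hg n
    simp only [cyclicValue, h0, Finset.Ico_self, Finset.sum_empty, zero_add, h.cst_add] at h1 h2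
    exact_mod_cast h1.symm.trans h2
  · exact h.reduces_of_pos hR hg

end CyclicWeights

theorem reduces_of_weightedProduct {f g : ℕ → ℕ} {α : List Weight} (hα : α ≠ [])
    (h : ∀ n, weightedProduct α f n = g n) : Reduces (blockSeq f) (blockSeq g) := by
  obtain ⟨m, R, coef, cst, K, hw, hv⟩ := exists_cyclicWeights α hα
  exact hw.reduces fun j => by rw [← hv, h]

/-! ### Block structure of a transduct -/

/-- A decomposition of a transduct of `⟨f⟩`: the output for block `n` of the input occupies the
positions from `B n` to `B (n + 1)`, and after a beginning of length `a n` it repeats `k n` times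
a word of length `A n`. Lengths and words depend only on the residue of `n` modulo `r`. -/
structure BlockData (f : ℕ → ℕ) (σ : ℕ → Bool) (r P : ℕ) (B a A c k : ℕ → ℕ) : Prop where
  r_pos : 0 < r
  P_pos : 0 < P
  a_add : ∀ n, a (n + r) = a n
  A_add : ∀ n, A (n + r) = A n
  c_add : ∀ n, c (n + r) = c n
  eq_add : ∀ n, f n = c n + P * k n
  k_tendsto : Tendsto k atTop atTop
  B_succ : ∀ n, B (n + 1) = B n + (a n + A n * k n)
  B_tendsto : Tendsto B atTop atTop
  same : ∀ n t j, j < a n + A n * k n → j < a n + A n * k (n + t * r) →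
    σ (B n + j) = σ (B (n + t * r) + j)
  repeats : ∀ n j, a n ≤ j → j + A n < a n + A n * k n → σ (B n + (j + A n)) = σ (B n + j)

theorem exists_iterate_eq {S : Type*} [Finite S] (z : S → S) :
    ∃ N P, 0 < P ∧ ∀ i t, N ≤ i → z^[i + P * t] = z^[i] := by
  obtain ⟨i, j, hne, h⟩ := Finite.exists_ne_map_eq_of_infinite fun i : ℕ => z^[i]
  wlog hij : i < j generalizing i j
  · exact this j i hne.symm h.symm (by omega)
  refine ⟨i, j - i, by omega, fun n t hn => ?_⟩
  obtain ⟨n, rfl⟩ := Nat.exists_eq_add_of_le' hn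
  induction t with
  | zero => rfl
  | succ t ih =>
    have e : n + i + (j - i) * (t + 1) = n + (j - i) * t + j := by
      rw [mul_add]; omega
    rw [e, Function.iterate_add, ← h, ← Function.iterate_add, ← ih]
    congr 1
    omega

theorem iterate_eq_of_mod_eq {S : Type*} {z : S → S} {N P : ℕ}
    (h : ∀ i t, N ≤ i → z^[i + P * t] = z^[i]) {i j : ℕ} (hi : N ≤ i) (hj : N ≤ j)
    (hm : i % P = j % P) : z^[i] = z^[j] := by
  wlog hij : i ≤ j generalizing i j
  · exact (this hj hi hm.symm (by omega)).symm
  obtain ⟨t, ht⟩ := (Nat.modEq_iff_dvd' hij).1 hm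
  rw [show j = i + P * t by omega, h i t hi]

theorem UltimatelyPeriodic.add_mul {A : Type*} {u : ℕ → A} {n₀ p : ℕ}
    (h : ∀ n, n₀ ≤ n → u (n + p) = u n) {n : ℕ} (hn : n₀ ≤ n) (t : ℕ) : u (n + p * t) = u n := by
  induction t with
  | zero => rfl
  | succ t ih => rw [mul_add, mul_one, ← add_assoc, h _ (by omega), ih]

/-- The state at the end of a long block depends only on the state at its beginning and on `f n`
modulo `P`. So once the state recurs at block starts whose distance is a multiple of the period of
`f` modulo `P`, it recurs for ever. -/
theorem Spiralling.exists_blockData {f : ℕ → ℕ} (hf : Spiralling f) {σ : ℕ → Bool}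
    (hσ : Reduces (blockSeq f) σ) :
    ∃ n₀ r P B a A c k, BlockData (shift n₀ f) σ r P B a A c k := by
  obtain ⟨S, _, next, s, ℓ, hr, hnext⟩ := hσ.exists_isRun
  obtain ⟨N, P, hP, hz⟩ := exists_iterate_eq fun q => next q false
  have hI (n i : ℕ) (hi : i ≤ f n) :
      s (blockPos f n + 1 + i) = (fun q => next q false)^[i] (next (s (blockPos f n)) true) := by
    induction i with
    | zero =>
      have := blockSeq_blockPos_add f (Nat.zero_le (f n))
      rw [add_zero] at this ⊢
      rw [hnext, this]
      rfl
    | succ i ih =>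
      have := blockSeq_blockPos_add f hi
      rw [← add_assoc, hnext, ih (by omega), Function.iterate_succ_apply', add_assoc, add_comm 1,
        this]
      rfl
  have hsucc (n : ℕ) : blockPos f (n + 1) = blockPos f n + 1 + f n := by rw [blockPos_succ]; ring
  obtain ⟨n₁, p, hp, hfp⟩ := hf.2 P hP
  -- Blocks of length `N + P` or more contain at least one full loop, so that `A` can be measured
  -- inside the block.
  obtain ⟨n₂, hn₂⟩ := (eventually_atTop.1 (hf.1.eventually_ge_atTop (N + P)))
  obtain ⟨M, M', hne, hM⟩ := Finite.exists_ne_map_eq_of_infinite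
    fun M : ℕ => s (blockPos f (max n₁ n₂ + p * M))
  wlog hMM : M < M' generalizing M M'
  · exact this M' M hne.symm hM.symm (by omega)
  obtain ⟨d, rfl⟩ := Nat.exists_eq_add_of_lt hMM
  set n₀ := max n₁ n₂ + p * M with hn₀
  set r := p * (d + 1) with hr_def
  have hr0 : 0 < r := Nat.mul_pos hp (by omega)
  have hfr (n : ℕ) : f (n + n₀ + r) % P = f (n + n₀) % P :=
    UltimatelyPeriodic.add_mul (u := fun n => f n % P) hfp (n := n + n₀) (by omega) (d + 1)
  have hfN (n : ℕ) : N + P ≤ f (n + n₀) := hn₂ _ (by omega)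
  have hsr (n : ℕ) : s (blockPos f (n + n₀ + r)) = s (blockPos f (n + n₀)) := by
    induction n with
    | zero =>
      rw [zero_add, hM]
      congr 2
      rw [hn₀, hr_def]
      ring
    | succ n ih =>
      have h1 := hfr n
      have h2 := hfN n
      have h3 := hfN (n + r)
      rw [add_right_comm n r] at h3
      rw [add_right_comm n 1 n₀, add_right_comm (n + n₀) 1 r, hsucc, hsucc, hI _ _ le_rfl,
        hI _ _ le_rfl, ih, iterate_eq_of_mod_eq hz (by omega) (by omega) h1]
  have hsrt (n t : ℕ) : s (blockPos f (n + n₀)) = s (blockPos f (n + t * r + n₀)) := by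
    induction t with
    | zero => simp
    | succ t ih =>
      rw [ih, ← hsr]
      congr 2
      ring
  let F (n : ℕ) : ℕ := f (n + n₀)
  let J (n : ℕ) : ℕ := blockPos f (n + n₀)
  -- The `c n` zeros include the preperiod `N`, and incomplete loops are put first: what remains is
  -- `k n` whole loops.
  let c (n : ℕ) : ℕ := N + (F n - N) % P
  let k (n : ℕ) : ℕ := (F n - N) / P
  let a (n : ℕ) : ℕ := ℓ (J n + (1 + c n)) - ℓ (J n)
  let A (n : ℕ) : ℕ := ℓ (J n + (1 + c n + P)) - ℓ (J n + (1 + c n))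
  have hFck (n : ℕ) : F n = c n + P * k n := by
    have := Nat.mod_add_div (F n - N) P
    have := hfN n
    simp only [c, k, F] at *
    omega
  have hcP (n : ℕ) : c n + P ≤ F n := by
    have h1 : 1 ≤ k n := (Nat.le_div_iff_mul_le hP).2 (by have := hfN n; simp only [F]; omega)
    have h2 := hFck n
    nlinarith
  have hcN (n : ℕ) : N ≤ c n := Nat.le_add_right _ _
  have hcr (n : ℕ) : c (n + r) = c n := by
    have h1 := hfN n
    have h2 := hfN (n + r)
    have h3 : F (n + r) ≡ F n [MOD P] := by
      have := hfr n
      rwa [add_right_comm] at this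
    simp only [c]
    congr 1
    refine Nat.ModEq.add_right_cancel' N ?_
    rwa [Nat.sub_add_cancel (by simp only [F]; omega), Nat.sub_add_cancel (by simp only [F]; omega)]
  have hpar (n t K : ℕ) (h1 : K ≤ F n) (h2 : K ≤ F (n + t * r)) :=
    (hr.parallel (hsrt n t) (1 + K) fun i hi => by
      rw [blockSeq_blockPos_add f (by simp only [F] at h1; omega),
        blockSeq_blockPos_add f (by simp only [F] at h2; omega)]).2
  have ha (n : ℕ) : ℓ (J n + (1 + c n)) = ℓ (J n) + a n := by
    have := hr.mono (Nat.le_add_right (J n) (1 + c n))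
    simp only [a]
    omega
  have hA (n : ℕ) : ℓ (J n + (1 + c n + P)) = ℓ (J n) + a n + A n := by
    have := hr.mono (show J n + (1 + c n) ≤ J n + (1 + c n + P) by omega)
    rw [← ha]
    simp only [A]
    omega
  have hrep (n t K : ℕ) (h1 : c n + P * t + K ≤ F n) :=
    (hr.parallel (m := J n + (1 + c n)) (n := J n + (1 + c n) + P * t) (by
      simp only [J]
      rw [← add_assoc, hI _ _ (by simp only [F] at h1; omega), add_assoc _ (c n), hI, hz _ _ (hcN n)]
      simp only [F] at h1
      omega) K fun i hi => by
      simp only [J]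
      rw [add_assoc, add_assoc _ (1 + c n), add_assoc (blockPos f (n + n₀)),
        blockSeq_blockPos_add f (by simp only [F] at h1; omega),
        blockSeq_blockPos_add f (by simp only [F] at h1; omega)]
      rw [decide_eq_decide]
      omega).2
  have hlen (n t : ℕ) (ht : t ≤ k n) :
      ℓ (J n + (1 + c n) + P * t) = ℓ (J n) + a n + A n * t := by
    induction t with
    | zero => simpa using ha n
    | succ t ih =>
      have h1 : P * (t + 1) ≤ P * k n := Nat.mul_le_mul_left _ ht
      obtain ⟨L, h2, h3, -⟩ := hrep n t P (by rw [hFck]; rw [mul_add] at h1; omega)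
      have h4 := hA n
      rw [← add_assoc, h2, ha] at h4
      rw [mul_add, mul_one, ← add_assoc, h3, ih (by omega), mul_add]
      omega
  have hJ (n : ℕ) : J (n + 1) = J n + (1 + c n) + P * k n := by
    have h1 := hsucc (n + n₀)
    have h2 := hFck n
    simp only [J, F] at *
    rw [add_right_comm, h1, h2]
    ring
  have hB (n : ℕ) : ℓ (J (n + 1)) = ℓ (J n) + (a n + A n * k n) := by
    rw [hJ, hlen n _ le_rfl, add_assoc]
  have har (n : ℕ) : a (n + r) = a n := by
    have h1 := hcP n
    have h2 := hcP (n + r)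
    rw [hcr] at h2
    obtain ⟨L, h3, h4, -⟩ := hpar n 1 (c n) (by omega) (by rw [one_mul]; omega)
    have h5 := ha n
    have h6 := ha (n + r)
    rw [one_mul] at h4
    rw [hcr] at h6
    simp only [J] at h5 h6
    omega
  have hAr (n : ℕ) : A (n + r) = A n := by
    have h1 := hcP n
    have h2 := hcP (n + r)
    rw [hcr] at h2
    obtain ⟨L, h3, h4, -⟩ := hpar n 1 (c n + P) h1 (by rwa [one_mul])
    have h5 := hA n
    have h6 := hA (n + r)
    rw [one_mul, ← add_assoc 1] at h4
    rw [← add_assoc 1] at h3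
    rw [hcr, har] at h6
    simp only [J] at h5 h6
    omega
  have hart (n t : ℕ) : a (n + t * r) = a n := by
    simpa using Function.Periodic.nat_mul (show Function.Periodic a r from har) t n
  have hArt (n t : ℕ) : A (n + t * r) = A n := by
    simpa using Function.Periodic.nat_mul (show Function.Periodic A r from hAr) t n
  refine ⟨n₀, r, P, fun n => ℓ (J n), a, A, c, k, hr0, hP, har, hAr, hcr, hFck, ?_, hB, ?_, ?_, ?_⟩
  · refine tendsto_atTop.2 fun C => ?_
    have h1 : Tendsto F atTop atTop := hf.1.comp (tendsto_add_atTop_nat n₀)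
    filter_upwards [h1.eventually_ge_atTop (N + C * P)] with n hn
    exact (Nat.le_div_iff_mul_le hP).2 (by omega)
  · exact hr.tendsto.comp ((blockPos_strictMono f).tendsto_atTop.comp (tendsto_add_atTop_nat n₀))
  · intro n t j h1 h2
    rcases le_total (F n) (F (n + t * r)) with h | h
    · obtain ⟨L, h3, h4, h5⟩ := hpar n t (F n) le_rfl h
      refine h5 j ?_
      have h6 := hB n
      rw [hJ, add_assoc (J n), add_assoc 1, ← hFck] at h6
      simp only [J] at h6
      omega
    · obtain ⟨L, h3, h4, h5⟩ := hpar n t (F (n + t * r)) h le_rfl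
      refine h5 j ?_
      have h6 := hB (n + t * r)
      rw [hJ, add_assoc (J _), add_assoc 1, ← hFck, hart, hArt] at h6
      simp only [J] at h6
      omega
  · intro n j h1 h2
    obtain ⟨j, rfl⟩ := Nat.exists_eq_add_of_le h1
    obtain ⟨K, hK⟩ : ∃ K, k n = K + 1 := Nat.exists_eq_succ_of_ne_zero fun h => by
      rw [h] at h2; omega
    obtain ⟨L, h3, h4, h5⟩ := hrep n 1 (P * K) (by rw [hFck, hK]; ring_nf; rfl)
    have h6 := hlen n 1 (by omega)
    have h7 := hlen n K (by omega)
    rw [ha] at h3 h5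
    rw [h6] at h5
    rw [hK, mul_add] at h2
    have h8 := h5 j (by omega)
    rw [add_assoc, mul_one, add_assoc] at h8
    rw [h8]
    congr 1
    ring

/-! ### Limit forms and silent block ends -/

namespace BlockData

variable {f : ℕ → ℕ} {σ : ℕ → Bool} {r P : ℕ} {B a A c k : ℕ → ℕ}

theorem periodic_mul {T : Type*} {u : ℕ → T} (h : ∀ n, u (n + r) = u n) (n t : ℕ) :
    u (n + t * r) = u n := by
  simpa using Function.Periodic.nat_mul (show Function.Periodic u r from h) t n

theorem B_mono (h : BlockData f σ r P B a A c k) : Monotone B :=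
  monotone_nat_of_le_succ fun n => by rw [h.B_succ]; omega

theorem lt_length {a A k i : ℕ} (hA : 0 < A) (hk : i < k) : i < a + A * k := by nlinarith

theorem exists_lt_B (h : BlockData f σ r P B a A c k) (n x : ℕ) : ∃ u, x < B (n + u) := by
  obtain ⟨N, hN⟩ := eventually_atTop.1 (h.B_tendsto.eventually_gt_atTop x)
  exact ⟨N, hN _ (by omega)⟩

/-- A block with `A n > 0` is eventually longer than `i`. A block with `A n = 0` has the fixed
length `a n`, and the comparison passes to the next block; `B_tendsto` bounds the number of such
passages. -/
theorem exists_stable (h : BlockData f σ r P B a A c k) (i : ℕ) :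
    ∃ N, ∀ n, N ≤ n → ∀ j ≤ i, ∀ t, σ (B n + j) = σ (B (n + t * r) + j) := by
  obtain ⟨N, hN⟩ := eventually_atTop.1 (h.k_tendsto.eventually_gt_atTop i)
  have key (u : ℕ) : ∀ n, N ≤ n → ∀ j ≤ i, B n + j < B (n + u) → ∀ t,
      σ (B n + j) = σ (B (n + t * r) + j) := by
    induction u with
    | zero => intro n _ j _ hj; simp at hj
    | succ u ih =>
      intro n hn j hji hj t
      rcases Nat.eq_zero_or_pos (A n) with hA | hA
      · rcases lt_or_ge j (a n) with hja | hja
        · exact h.same n t j (by omega) (by omega)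
        · have h1 := h.B_succ n
          have h2 := h.B_succ (n + t * r)
          rw [periodic_mul h.A_add, periodic_mul h.a_add, hA] at h2
          rw [hA] at h1
          have h3 := ih (n + 1) (by omega) (j - a n) (by omega)
            (by rw [add_assoc, add_comm 1]; omega) t
          rw [add_right_comm] at h3
          rwa [show B (n + 1) + (j - a n) = B n + j by omega,
            show B (n + t * r + 1) + (j - a n) = B (n + t * r) + j by omega] at h3
      · exact h.same n t j (lt_length hA (hji.trans_lt (hN n hn)))
          (lt_length hA (hji.trans_lt (hN _ (by omega))))
  refine ⟨N, fun n hn j hj t => ?_⟩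
  obtain ⟨u, hu⟩ := h.exists_lt_B n (B n + j)
  exact key u n hn j hj hu t

/-- `X n` is the limit, for `t → ∞`, of what `σ` looks like from the beginning of block
`n + t * r`. -/
structure IsLimit (σ : ℕ → Bool) (r : ℕ) (B : ℕ → ℕ) (X : ℕ → ℕ → Bool) : Prop where
  add : ∀ n, X (n + r) = X n
  eventually : ∀ i, ∃ N, ∀ n, N ≤ n → ∀ j ≤ i, X n j = σ (B n + j)

theorem exists_isLimit (h : BlockData f σ r P B a A c k) : ∃ X, IsLimit σ r B X := by
  choose N hN using h.exists_stable
  have h0 (i n : ℕ) : N i ≤ n + N i * r :=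
    (Nat.le_mul_of_pos_right _ h.r_pos).trans (Nat.le_add_left _ _)
  refine ⟨fun n i => σ (B (n + N i * r) + i), fun n => funext fun i => ?_, fun i => ?_⟩
  · have h1 := hN i _ (h0 i n) i le_rfl 1
    rw [one_mul, add_right_comm] at h1
    exact h1.symm
  · refine ⟨∑ j ∈ Finset.range (i + 1), N j, fun n hn j hj => ?_⟩
    have h1 : N j ≤ n := (Finset.single_le_sum (f := N) (fun _ _ => Nat.zero_le _)
      (Finset.mem_range.2 (by omega))).trans hn
    exact (hN j n h1 j le_rfl _).symm

variable {X : ℕ → ℕ → Bool}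

/-- Transfers facts about `σ` to `X`: far along the residue class of `n`, the block and its
successor both show the limit form up to `i`. -/
theorem exists_large (h : BlockData f σ r P B a A c k) (hX : IsLimit σ r B X) (n i : ℕ) :
    ∃ t, i < k (n + t * r) ∧ ∀ j ≤ i, ∀ e ≤ 1, X (n + e) j = σ (B (n + t * r + e) + j) := by
  obtain ⟨N₁, hN₁⟩ := eventually_atTop.1 (h.k_tendsto.eventually_gt_atTop i)
  obtain ⟨N₂, hN₂⟩ := hX.eventually i
  have h0 : N₁ + N₂ ≤ (N₁ + N₂) * r := Nat.le_mul_of_pos_right _ h.r_pos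
  refine ⟨N₁ + N₂, hN₁ _ (by omega), fun j hj e _ => ?_⟩
  rw [← hN₂ _ (by omega) j hj, add_right_comm, periodic_mul hX.add]

theorem limit_eq (h : BlockData f σ r P B a A c k) (hX : IsLimit σ r B X) {n i : ℕ}
    (hi : i < a n + A n * k n) : X n i = σ (B n + i) := by
  obtain ⟨t, h1, h2⟩ := h.exists_large hX n i
  refine (h2 i le_rfl 0 (by omega)).trans (h.same n t i hi ?_).symm
  rcases Nat.eq_zero_or_pos (A n) with hA | hA
  · rw [hA] at hi ⊢; omega
  · exact lt_length hA h1

theorem limit_add (h : BlockData f σ r P B a A c k) (hX : IsLimit σ r B X) {n i : ℕ}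
    (hi : a n ≤ i) : X n (i + A n) = X n i := by
  rcases Nat.eq_zero_or_pos (A n) with hA | hA
  · rw [hA, add_zero]
  · obtain ⟨t, h1, h2⟩ := h.exists_large hX n (i + A n)
    have h3 := h2 i (by omega) 0 (by omega)
    have h4 := h2 (i + A n) le_rfl 0 (by omega)
    rw [add_zero] at h3 h4
    rw [h3, h4]
    have h5 := h.repeats (n + t * r) i
    rw [periodic_mul h.a_add, periodic_mul h.A_add] at h5
    exact h5 hi (lt_length hA h1)

/-- By periodicity, the prediction at the end of block `n` does not depend on the number `k n` of
rounds. -/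
theorem limit_length_add (h : BlockData f σ r P B a A c k) (hX : IsLimit σ r B X) (n i : ℕ) :
    X n (a n + A n * k n + i) = X n (a n + i) := by
  induction k n with
  | zero => rfl
  | succ t ih =>
    rw [← ih, ← h.limit_add hX (i := a n + A n * t + i) (by omega), mul_add, mul_one]
    congr 1
    omega

theorem limit_of_eq_zero (h : BlockData f σ r P B a A c k) (hX : IsLimit σ r B X) {n : ℕ}
    (hA : A n = 0) (i : ℕ) : X n (a n + i) = X (n + 1) i := by
  obtain ⟨t, h1, h2⟩ := h.exists_large hX n (a n + i)
  have h3 := h2 (a n + i) le_rfl 0 (by omega)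
  have h4 := h.B_succ (n + t * r)
  rw [periodic_mul h.a_add, periodic_mul h.A_add, hA] at h4
  rw [h2 i (by omega) 1 le_rfl, h4]
  simp only [add_zero] at h3
  rw [h3]
  congr 1
  omega

/-- The end of block `n` is silent if continuing the repetitions of the block for ever agrees with
the limit form of what follows. -/
def Silent (a : ℕ → ℕ) (X : ℕ → ℕ → Bool) (n : ℕ) : Prop := ∀ i, X n (a n + i) = X (n + 1) i

theorem silent_add (h : BlockData f σ r P B a A c k) (hX : IsLimit σ r B X) (n t : ℕ) :
    Silent a X (n + t * r) ↔ Silent a X n := by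
  simp only [Silent]
  rw [add_right_comm, periodic_mul hX.add, periodic_mul hX.add, periodic_mul h.a_add]

/-- If no end is noticed, `X n` is the actual tail of `σ` from `B n`, and `X` repeats with period
`r`. -/
theorem ultimatelyPeriodic_of_silent (h : BlockData f σ r P B a A c k) (hX : IsLimit σ r B X)
    (hs : ∀ n, Silent a X n) : UltimatelyPeriodic σ := by
  have key (u : ℕ) : ∀ n j, B n + j < B (n + u) → X n j = σ (B n + j) := by
    induction u with
    | zero => intro n j hj; simp at hj
    | succ u ih =>
      intro n j hj
      rcases lt_or_ge j (a n + A n * k n) with h1 | h1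
      · exact h.limit_eq hX h1
      · obtain ⟨j, rfl⟩ := Nat.exists_eq_add_of_le h1
        have h2 := h.B_succ n
        rw [h.limit_length_add hX, hs, ih _ _ (by rw [add_assoc, add_comm 1]; omega)]
        congr 1
        omega
  have key' (n j : ℕ) : X n j = σ (B n + j) := by
    obtain ⟨u, hu⟩ := h.exists_lt_B n (B n + j)
    exact key u n j hu
  obtain ⟨u, hu⟩ := h.exists_lt_B 0 (B 0)
  have h1 : B (0 + u) ≤ B (0 + u * r) :=
    h.B_mono (Nat.add_le_add_left (Nat.le_mul_of_pos_right _ h.r_pos) _)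
  refine ⟨B 0, B (0 + u * r) - B 0, by omega, fun n hn => ?_⟩
  have h2 := key' 0 (n - B 0)
  have h3 := key' (0 + u * r) (n - B 0)
  rw [periodic_mul hX.add, h2] at h3
  rw [show n + (B (0 + u * r) - B 0) = B (0 + u * r) + (n - B 0) by omega, ← h3]
  congr 1
  omega

/-- A non-silent end forces `A > 0` there. Hence from any `n` a block with a genuine loop is reached
after finitely many blocks with `A = 0`, each of which only prepends a word to the limit form. -/
theorem ultimatelyPeriodic_limit (h : BlockData f σ r P B a A c k) (hX : IsLimit σ r B X) {e : ℕ}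
    (he : ¬ Silent a X e) (n : ℕ) : UltimatelyPeriodic (X n) := by
  have key (u : ℕ) : ∀ n, ¬ Silent a X (n + u) → UltimatelyPeriodic (X n) := by
    have hpos {n : ℕ} (hA : 0 < A n) : UltimatelyPeriodic (X n) :=
      ⟨a n, A n, hA, fun i hi => h.limit_add hX hi⟩
    induction u with
    | zero =>
      intro n hn
      exact hpos (Nat.pos_of_ne_zero fun hA => hn (h.limit_of_eq_zero hX hA))
    | succ u ih =>
      intro n hn
      rcases Nat.eq_zero_or_pos (A n) with hA | hA
      · obtain ⟨N, p, hp, h1⟩ := ih (n + 1) (by rwa [add_assoc, add_comm 1])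
        refine ⟨a n + N, p, hp, fun i hi => ?_⟩
        obtain ⟨i, rfl⟩ := Nat.exists_eq_add_of_le ((Nat.le_add_right _ _).trans hi)
        rw [add_assoc, h.limit_of_eq_zero hX hA, h.limit_of_eq_zero hX hA, h1 i (by omega)]
      · exact hpos hA
  have h1 : n ≤ e + n * r := (Nat.le_mul_of_pos_right _ h.r_pos).trans (Nat.le_add_left _ _)
  refine key (e + n * r - n) n ?_
  rwa [Nat.add_sub_cancel' h1, h.silent_add hX]

end BlockData

/-! ### Encoding a transduct by its non-silent ends -/

/-- The members, from one on, of a periodic set of numbers in increasing order. -/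
theorem exists_enumeration {p : ℕ → Prop} {r e : ℕ} (hr : 0 < r) (hp : ∀ n, p (n + r) ↔ p n)
    (he : p e) : ∃ (E : ℕ → ℕ) (m : ℕ), 0 < m ∧ StrictMono E ∧ E 0 = e ∧ (∀ i, p (E i)) ∧
      (∀ i n, E i < n → n < E (i + 1) → ¬ p n) ∧ ∀ i, E (i + m) = E i + r := by
  classical
  have hmul (t : ℕ) : p (e + t * r) := by
    have : Function.Periodic p r := fun n => propext (hp n)
    have := this.nat_mul t e
    simp only [Nat.cast_id] at this
    rwa [this]
  have hex (n : ℕ) : ∃ q, n < q ∧ p q :=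
    ⟨e + (n + 1) * r, by nlinarith, hmul _⟩
  let nx (n : ℕ) : ℕ := Nat.find (hex n)
  have hnx (n : ℕ) : n < nx n ∧ p (nx n) := Nat.find_spec (hex n)
  have hmin {n q : ℕ} (h1 : n < q) (h2 : p q) : nx n ≤ q := Nat.find_min' (hex n) ⟨h1, h2⟩
  have hnx_add (n : ℕ) : nx (n + r) = nx n + r := by
    have h1 := hnx n
    have h2 := hnx (n + r)
    refine (hmin (by omega) ((hp _).2 h1.2)).antisymm ?_
    have h3 : nx n ≤ nx (n + r) - r :=
      hmin (by omega) ((hp _).1 (by rw [Nat.sub_add_cancel (by omega)]; exact h2.2))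
    omega
  let E (i : ℕ) : ℕ := nx^[i] e
  have hE (i : ℕ) : E (i + 1) = nx (E i) := Function.iterate_succ_apply' _ _ _
  have hmono : StrictMono E := strictMono_nat_of_lt_succ fun i => by rw [hE]; exact (hnx _).1
  have hEp (i : ℕ) : p (E i) := by
    cases i with
    | zero => exact he
    | succ i => rw [hE]; exact (hnx _).2
  have hreach : ∃ m, e + r ≤ E m := ⟨e + r, hmono.le_apply⟩
  obtain ⟨m, hm⟩ : ∃ m, Nat.find hreach = m + 1 :=
    Nat.exists_eq_succ_of_ne_zero fun h => by
      have := Nat.find_spec hreach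
      rw [h] at this
      change e + r ≤ e at this
      omega
  have hm1 : e + r ≤ E (m + 1) := hm ▸ Nat.find_spec hreach
  have hm2 : E m < e + r := not_le.1 (Nat.find_min hreach (by omega))
  refine ⟨E, m + 1, Nat.succ_pos _, hmono, rfl, hEp, fun i n h1 h2 h3 => ?_, fun i => ?_⟩
  · have := hmin h1 h3
    rw [hE] at h2
    omega
  · induction i with
    | zero =>
      rw [zero_add]
      exact (show E (m + 1) ≤ e + r from hE m ▸ hmin hm2 ((hp _).2 he)).antisymm hm1
    | succ i ih => rw [add_right_comm, hE, hE, ih, hnx_add]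

namespace BlockData

variable {f : ℕ → ℕ} {σ : ℕ → Bool} {r P : ℕ} {B a A c k : ℕ → ℕ}

/-- A transduct of `⟨f⟩` that is not ultimately periodic is determined, up to equivalence, by the
places where it differs from the limit form of what precedes. -/
theorem exists_equivalent (h : BlockData f σ r P B a A c k) (hσ : ¬ UltimatelyPeriodic σ) :
    ∃ (E d g : ℕ → ℕ) (m : ℕ), 0 < m ∧ StrictMono E ∧ (∀ i, E (i + m) = E i + r) ∧
      (∀ i, d (i + m) = d i) ∧
      (∀ i, B (E (i + 1) + 1) + d (i + 1) = B (E i + 1) + d i + (g i + 1)) ∧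
      Equivalent σ (blockSeq g) := by
  obtain ⟨X, hX⟩ := h.exists_isLimit
  obtain ⟨e, he⟩ : ∃ e, ¬ Silent a X e := by
    by_contra! hs
    exact hσ (h.ultimatelyPeriodic_of_silent hX hs)
  have hUP := h.ultimatelyPeriodic_limit hX he
  -- The distance behind a non-silent end at which the prediction first fails; `0` at silent ends.
  let δ (n : ℕ) : ℕ := sInf {i | X n (a n + i) ≠ X (n + 1) i}
  have hδ_add (n : ℕ) : δ (n + r) = δ n := by
    simp only [δ]
    rw [add_right_comm, hX.add, hX.add, h.a_add]
  have hδ_ne {n : ℕ} (hn : ¬ Silent a X n) : X n (a n + δ n) ≠ X (n + 1) (δ n) :=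
    Nat.sInf_mem (s := {i | X n (a n + i) ≠ X (n + 1) i}) (not_forall.1 hn)
  have hδ_eq {n i : ℕ} (hi : i < δ n) : X n (a n + i) = X (n + 1) i :=
    not_not.1 (Nat.notMem_of_lt_sInf hi)
  obtain ⟨D, hD⟩ : ∃ D, ∀ n, δ n ≤ D := by
    refine ⟨∑ i ∈ Finset.range r, δ i, fun n => ?_⟩
    rw [← (show Function.Periodic δ r from hδ_add).map_mod_nat n]
    exact Finset.single_le_sum (f := δ) (fun _ _ => Nat.zero_le _)
      (Finset.mem_range.2 (Nat.mod_lt n h.r_pos))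
  obtain ⟨n₁, hn₁⟩ := hX.eventually D
  obtain ⟨n₂, hn₂⟩ := eventually_atTop.1 (h.k_tendsto.eventually_gt_atTop D)
  -- Starting this late, `σ` shows the limit form up to the bound `D` behind each end, and every
  -- block with a non-silent end is longer than `D`; so a failure occurs before the next non-silent
  -- end.
  obtain ⟨E, m, hm, hE, hE0, hES, hEs, hEm⟩ := exists_enumeration (p := fun n => ¬ Silent a X n)
    (e := e + (n₁ + n₂) * r) h.r_pos
    (fun n => by
      have := h.silent_add hX n 1
      rw [one_mul] at this
      rw [this])
    (by rwa [h.silent_add hX])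
  have hEn (i : ℕ) : n₁ + n₂ ≤ E i := by
    have h1 := hE.monotone (Nat.zero_le i)
    have h2 : n₁ + n₂ ≤ (n₁ + n₂) * r := Nat.le_mul_of_pos_right _ h.r_pos
    omega
  have hlen (i : ℕ) : D < a (E i) + A (E i) * k (E i) :=
    lt_length (Nat.pos_of_ne_zero fun hA => hES i (h.limit_of_eq_zero hX hA))
      (hn₂ _ (by have := hEn i; omega))
  let M (i : ℕ) : ℕ := B (E i + 1) + δ (E i)
  have hBE (i : ℕ) : B (E i + 1) ≤ B (E (i + 1)) := h.B_mono (hE (Nat.lt_succ_self i))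
  have hM (i : ℕ) : M i < M (i + 1) := by
    have h1 := hBE i
    have h2 := h.B_succ (E (i + 1))
    have h3 := hlen (i + 1)
    have h4 := hD (E i)
    simp only [M]
    omega
  -- Silent ends do not disturb the prediction: `X (E i + 1)` keeps describing `σ` across them, up
  -- to the next non-silent end.
  have hfollow (i u : ℕ) : E i + 1 + u ≤ E (i + 1) →
      (∀ x, X (E i + 1) (B (E i + 1 + u) - B (E i + 1) + x) = X (E i + 1 + u) x) ∧
      ∀ x, B (E i + 1) + x < B (E i + 1 + u) → X (E i + 1) x = σ (B (E i + 1) + x) := by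
    induction u with
    | zero => exact fun _ => ⟨fun x => by simp, fun x hx => by simp at hx⟩
    | succ u ih =>
      intro hu
      obtain ⟨h1, h2⟩ := ih (by omega)
      have h3 := h.B_succ (E i + 1 + u)
      have h4 : B (E i + 1) ≤ B (E i + 1 + u) := h.B_mono (Nat.le_add_right _ _)
      have h5 : Silent a X (E i + 1 + u) := not_not.1 (hEs i _ (by omega) (by omega))
      rw [← add_assoc]
      refine ⟨fun x => ?_, fun x hx => ?_⟩
      · rw [← h5, ← h.limit_length_add hX, ← h1]
        congr 1
        omega
      · rcases lt_or_ge (B (E i + 1) + x) (B (E i + 1 + u)) with h6 | h6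
        · exact h2 x h6
        · have h7 := h1 (B (E i + 1) + x - B (E i + 1 + u))
          rw [h.limit_eq hX (n := E i + 1 + u) (by omega)] at h7
          rw [show B (E i + 1 + u) + (B (E i + 1) + x - B (E i + 1 + u)) = B (E i + 1) + x by
            omega] at h7
          rw [← h7]
          congr 1
          omega
  have hfollow' (i : ℕ) := hfollow i (E (i + 1) - (E i + 1))
  have hEsucc (i : ℕ) : E i + 1 ≤ E (i + 1) := hE (Nat.lt_succ_self i)
  simp only [Nat.add_sub_cancel' (hEsucc _), le_refl, forall_const] at hfollow'
  have hend (i x : ℕ) : X (E i + 1) (B (E (i + 1) + 1) - B (E i + 1) + x) =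
      X (E (i + 1)) (a (E (i + 1)) + x) := by
    rw [← h.limit_length_add hX, ← (hfollow' i).1]
    have h1 := hBE i
    have h2 := h.B_succ (E (i + 1))
    congr 1
    omega
  have hpred (i x : ℕ) (hx : B (E i + 1) + x < M (i + 1)) :
      X (E i + 1) x = σ (B (E i + 1) + x) := by
    have h1 := hBE i
    have h2 := h.B_succ (E (i + 1))
    rcases lt_or_ge (B (E i + 1) + x) (B (E (i + 1))) with h3 | h3
    · exact (hfollow' i).2 x h3
    rcases lt_or_ge (B (E i + 1) + x) (B (E (i + 1) + 1)) with h4 | h4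
    · have h5 := (hfollow' i).1 (B (E i + 1) + x - B (E (i + 1)))
      rw [h.limit_eq hX (n := E (i + 1)) (by omega),
        show B (E (i + 1)) + (B (E i + 1) + x - B (E (i + 1))) = B (E i + 1) + x by omega] at h5
      rw [← h5]
      congr 1
      omega
    · have h5 := hend i (B (E i + 1) + x - B (E (i + 1) + 1))
      have h6 : B (E i + 1) + x - B (E (i + 1) + 1) < δ (E (i + 1)) := by
        simp only [M] at hx
        omega
      have h7 := hD (E (i + 1))
      rw [hδ_eq h6, hn₁ (E (i + 1) + 1) (by have := hEn (i + 1); omega) _ (by omega),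
        show B (E (i + 1) + 1) + (B (E i + 1) + x - B (E (i + 1) + 1)) = B (E i + 1) + x by
          omega] at h5
      rw [← h5]
      congr 1
      omega
  have hpred' (i : ℕ) : X (E i + 1) (M (i + 1) - B (E i + 1)) ≠ σ (M (i + 1)) := by
    have h1 := hBE i
    have h2 := h.B_succ (E (i + 1))
    have h3 := hend i (δ (E (i + 1)))
    have h4 := hδ_ne (hES (i + 1))
    rw [← h3, hn₁ (E (i + 1) + 1) (by have := hEn (i + 1); omega) _ (hD _)] at h4
    convert h4 using 2
    simp only [M]
    omega
  let g (i : ℕ) : ℕ := M (i + 1) - M i - 1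
  have hg (i : ℕ) : M (i + 1) = M i + (g i + 1) := by
    have := hM i
    simp only [g]
    omega
  refine ⟨E, fun i => δ (E i), g, m, hm, hE, hEm, fun i => by simp only [hEm, hδ_add], hg, ?_⟩
  have hMg (i : ℕ) : M i = M 0 + blockPos g i := by
    induction i with
    | zero => simp
    | succ i ih => rw [hg, ih, blockPos_succ, add_assoc]
  obtain ⟨N, Z, hZ, hNZ, hlt, heq, hletter⟩ := exists_blockIndex g
  have hMN (x : ℕ) : M 0 + 1 + x = M (N x) + 1 + Z x := by
    have h1 := hMg (N x)
    have h2 := hNZ x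
    omega
  have hτ (x : ℕ) : blockSeq g (1 + x) =
      (σ (M 0 + 1 + x) ^^ X (E (N x) + 1) (δ (E (N x)) + 1 + Z x + 0)) := by
    have h1 : M 0 + 1 + x = B (E (N x) + 1) + (δ (E (N x)) + 1 + Z x) := by
      have := hMN x
      simp only [M] at this ⊢
      omega
    have h2 := hg (N x)
    have h3 := hMN x
    rw [add_comm 1 x]
    rcases (hZ x).lt_or_eq with hx | hx
    · have h4 : blockSeq g (x + 1) = false := by
        rw [← Bool.not_eq_true, hletter]
        exact hx.ne
      rw [h4, add_zero, hpred _ _ (by omega), h1, Bool.xor_self]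
    · have h4 := hpred' (N x)
      rw [show M (N x + 1) = M 0 + 1 + x by omega] at h4
      rw [(hletter x).2 hx, add_zero, show δ (E (N x)) + 1 + Z x =
        M 0 + 1 + x - B (E (N x) + 1) by omega]
      exact (Bool.xor_iff_ne.2 h4.symm).symm
  have hEmul (i t : ℕ) : E (i + t * m) = E i + t * r := by
    induction t with
    | zero => simp
    | succ t ih => rw [add_mul, one_mul, ← add_assoc, hEm, ih]; ring
  have hEmod (i : ℕ) : X (E i + 1) = X (E (i % m) + 1) ∧ δ (E i) = δ (E (i % m)) := by
    rw [← Nat.mod_add_div' i m, hEmul, add_right_comm, periodic_mul hX.add, periodic_mul hδ_add]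
    simp
  refine (equivalent_drop σ (M 0 + 1)).trans (.trans ?_ (equivalent_drop (blockSeq g) 1).symm)
  -- The state holds which prediction is in use, modulo `m`, and its remaining tail. The letter of
  -- `σ` shows whether the prediction fails, and hence whether to pass to the next one.
  refine .of_prediction
    (s := fun x => (N x % m, fun j => X (E (N x) + 1) (δ (E (N x)) + 1 + Z x + j)))
    ?_ (fun q => q.2 0) ?_ hτ
  · refine (((Set.finite_Iio m).prod ((Set.finite_Iio r).biUnion fun n _ =>
      (hUP n).finite_range_drop))).subset ?_
    rintro _ ⟨x, rfl⟩
    refine ⟨Nat.mod_lt _ hm, ?_⟩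
    refine Set.mem_biUnion (show (E (N x) + 1) % r ∈ Set.Iio r from Nat.mod_lt _ h.r_pos)
      ⟨δ (E (N x)) + 1 + Z x, ?_⟩
    rw [(show Function.Periodic X r from hX.add).map_mod_nat]
  · intro x y hs hxy
    obtain ⟨h1, h2⟩ := Prod.mk.inj hs
    have h3 : blockSeq g (x + 1) = blockSeq g (y + 1) := by
      rw [add_comm x, add_comm y, hτ, hτ, hxy, congrFun h2 0]
    rcases (hZ x).lt_or_eq with hx | hx
    · have hy : Z y < g (N y) := by
        refine (hZ y).lt_of_ne fun hy => hx.ne ?_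
        rwa [← hletter, h3, hletter]
      rw [(hlt x hx).1, (hlt x hx).2, (hlt y hy).1, (hlt y hy).2, h1]
      congr 1
      funext j
      have := congrFun h2 (1 + j)
      simpa only [← add_assoc] using this
    · have hy : Z y = g (N y) := by rwa [← hletter, ← h3, hletter]
      have h4 : (N x + 1) % m = (N y + 1) % m := by
        rw [Nat.add_mod, h1, ← Nat.add_mod]
      rw [(heq x hx).1, (heq x hx).2, (heq y hy).1, (heq y hy).2, (hEmod _).1, (hEmod _).2, h4,
        ← (hEmod _).1, ← (hEmod _).2]

/-! ### Reading off the weights -/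

theorem sum_Ico_length (h : BlockData f σ r P B a A c k) {p q : ℕ} (hpq : p ≤ q) :
    ∑ i ∈ Finset.Ico p q, ((a i : ℚ) + A i * k i) = B q - B p := by
  induction q, hpq using Nat.le_induction with
  | base => simp
  | succ q hq ih =>
    rw [Finset.sum_Ico_succ_top hq, ih, h.B_succ]
    push_cast
    ring

theorem exists_weights (h : BlockData f σ r P B a A c k) :
    ∃ (n₀ : ℕ) (α : List Weight) (g : ℕ → ℕ), α ≠ [] ∧
      (∀ n, weightedProduct α (shift n₀ f) n = g n) ∧ Equivalent σ (blockSeq g) := by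
  by_cases hσ : UltimatelyPeriodic σ
  -- All ultimately periodic sequences are equivalent, so the single weight with constant `0` and no
  -- coefficients suffices.
  · have hw : CyclicWeights 1 0 0 0 0 := ⟨one_pos, fun _ => le_rfl, fun _ => rfl, fun _ => rfl, rfl,
      fun _ => le_rfl, fun _ => rfl⟩
    obtain ⟨α, hα, hv⟩ := hw.exists_weightedProduct
    refine ⟨0, α, 0, hα, fun n => by simp [hv, cyclicValue], ?_, hσ.reduces _⟩
    exact (blockSeq_ultimatelyPeriodic one_pos fun _ => rfl).reduces _
  obtain ⟨E, d, g, m, hm, hE, hEm, hdm, hg, heqv⟩ := h.exists_equivalent hσ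
  -- Substituting `k q = (f q - c q) / P` into the block length `a q + A q * k q` gives slope `A q /
  -- P`. The constant collects the rest, the change of the offset `d`, and `-1` for the letter 1 of
  -- each block of `⟨g⟩`.
  let coef (n : ℕ) : ℚ := A (E 0 + 1 + n) / P
  let cst (i : ℕ) : ℚ := ∑ q ∈ Finset.Ico (E i + 1) (E (i + 1) + 1), ((a q : ℚ) - A q * c q / P) +
    (d (i + 1) - d i - 1)
  have hE0 (i : ℕ) : E 0 ≤ E i := hE.monotone (Nat.zero_le i)
  have hw : CyclicWeights m r coef cst fun i => E i - E 0 := by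
    refine ⟨hm, fun n => by positivity, fun n => ?_, fun i => ?_, Nat.sub_self _, fun i => ?_,
      fun i => ?_⟩
    · simp only [coef]
      rw [← add_assoc, h.A_add]
    · simp only [cst]
      rw [add_right_comm i, hEm, hEm, hdm, hdm, add_right_comm, add_right_comm _ r,
        ← Finset.sum_Ico_add']
      simp only [h.a_add, h.A_add, h.c_add]
    · exact Nat.sub_le_sub_right (hE (Nat.lt_succ_self i)).le _
    · have := hE0 i
      rw [hEm]
      omega
  obtain ⟨α, hα, hv⟩ := hw.exists_weightedProduct
  refine ⟨E 0 + 1, α, g, hα, fun i => ?_, heqv⟩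
  have hP : (P : ℚ) ≠ 0 := by exact_mod_cast h.P_pos.ne'
  have h1 : ∑ q ∈ Finset.Ico (E i - E 0) (E (i + 1) - E 0), coef q * (shift (E 0 + 1) f q : ℚ) =
      ∑ q ∈ Finset.Ico (E i + 1) (E (i + 1) + 1), (A q : ℚ) / P * f q := by
    rw [show E i + 1 = E i - E 0 + (E 0 + 1) by have := hE0 i; omega,
      show E (i + 1) + 1 = E (i + 1) - E 0 + (E 0 + 1) by have := hE0 (i + 1); omega,
      ← Finset.sum_Ico_add']
    simp only [coef, shift, add_comm]
  have h2 := h.sum_Ico_length (show E i + 1 ≤ E (i + 1) + 1 by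
    have := hE (Nat.lt_add_one i); omega)
  have h3 : ((B (E (i + 1) + 1) + d (i + 1) : ℕ) : ℚ) = (B (E i + 1) + d i + (g i + 1) : ℕ) := by
    rw [hg]
  push_cast at h3
  rw [hv, cyclicValue, h1, show cst i = _ from rfl, ← add_assoc, ← Finset.sum_add_distrib,
    Finset.sum_congr rfl (g := fun q => (a q : ℚ) + A q * k q), h2]
  · linarith
  · intro q _
    rw [h.eq_add q]
    push_cast
    field_simp
    ring

end BlockData

end Transducibility

theorem mainTheorem2 (f : ℕ → ℕ) (hf : Transducibility.Spiralling f) (σ : ℕ → Bool) :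
    Transducibility.Reduces (Transducibility.blockSeq f) σ ↔
      ∃ (n₀ : ℕ) (α : List Transducibility.Weight) (g : ℕ → ℕ),
        α ≠ [] ∧
        (∀ n : ℕ, Transducibility.weightedProduct α (Transducibility.shift n₀ f) n = (g n : ℚ)) ∧
        Transducibility.Equivalent σ (Transducibility.blockSeq g) := by
  constructor
  · intro h
    obtain ⟨n₀, r, P, B, a, A, c, k, hd⟩ := hf.exists_blockData h
    obtain ⟨n₁, α, g, hα, hv, hg⟩ := hd.exists_weights
    refine ⟨n₁ + n₀, α, g, hα, ?_, hg⟩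
    have e : Transducibility.shift (n₁ + n₀) f =
        Transducibility.shift n₁ (Transducibility.shift n₀ f) := by
      funext n
      simp [Transducibility.shift, add_assoc]
    rwa [e]
  · rintro ⟨n₀, α, g, hα, hv, hg⟩
    exact ((Transducibility.blockSeq_equivalent_shift f n₀).1.trans
      (Transducibility.reduces_of_weightedProduct hα hv)).trans hg.2
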